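/- For integers $0\le m\le q$, $0\le n\le p$, complex $\alpha_j,\beta_j$ and reals $A_j,B_j>0$ put $$\Xi^{m,n}_{p,q}(s)=\frac{\prod_{j=1}^{m}\Gamma(\beta_j+B_js)\prod_{j=1}^{n}\Gamma(1-\alpha_j-A_js)}{\prod_{j=m+1}^{q}\Gamma(1-\beta_j-B_js)\prod_{j=n+1}^{p}\Gamma(\alpha_j+A_js)},\qquad \chi=\sum_{j=1}^{n}A_j-\sum_{j=n+1}^{p}A_j+\sum_{j=1}^{m}B_j-\sum_{j=m+1}^{q}B_j .$$ If no pole of a $\Gamma(\beta_{j'}+B_{j'}s)$, $j'\le m$, is a pole of a $\Gamma(1-\alpha_j-A_js)$, $j\le n$, and $\chi>0$, the Fox $H$-function is, for $t>0$, $$H^{m,n}_{p,q}\left[t\,\Big|\begin{array}{l}(\alpha_j,A_j)_1^p\\(\beta_j,B_j)_1^q\end{array}\right]=\frac1{2\pi i}\int_{\mathcal C}\Xi^{m,n}_{p,q}(s)\,t^{-s}\,ds,$$ where $\mathcal C$ is a contour from $\gamma-i\infty$ to $\gamma+i\infty$ ($\gamma\in\mathbb R$) with the poles of $\Gamma(\beta_j+B_js)$,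 $j\le m$, on its left and the poles of $\Gamma(1-\alpha_j-A_js)$, $j\le n$, on its right. **Corollary.** Let $0\le m'\le q'$, $0\le n'\le p'$, $m'n'>0$, let $\alpha'_j,\beta'_j$ be real and $A'_j,B'_j>0$, such that no pole of a $\Gamma(\beta'_{j'}+B'_{j'}s)$, $j'\le m'$, is a pole of a $\Gamma(1-\alpha'_j-A'_js)$, $j\le n'$, and such that the corresponding parameter $\chi'$ is positive. Suppose that $$H^{m',n'}_{p',q'}\left[t\,\Big|\begin{array}{l}(\alpha'_j,A'_j)_1^{p'}\\(\beta'_j,B'_j)_1^{q'}\end{array}\right]>0\quad\text{for every }t>0.$$ Let $k$ be a natural number and let $\omega_1,\dots,\omega_k$ and $\lambda_1,\dots,\lambda_k>0$ be real numbers with $$\omega_j+\lambda_j\min_{1\le l\le m'}\frac{\beta'_l}{B'_l}>0,\qquad j=1,\dots,k.$$ Then the following Fox $H$-function is well defined (the two groups of poles are disjoint and the integral converges) and positive for every $t>0$: $$H^{m',n'+k}_{p'+k,q'}\left[t\,\Big|\begin{array}{l}(1-\omega_{k-j+1},\lambda_{k-j+1})_{j=1}^{k},(\alpha'_j,A'_j)_1^{p'}\\(\beta'_j,B'_j)_1^{q'}\end{array}\right]>0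 .$$ -/

import Mathlib

open scoped ComplexOrder

noncomputable section

/-- An infinite broken line in the complex plane from `γ - i∞` to `γ + i∞`: the vertical ray from
`γ - i∞` to `γ - iR`, then straight segments through the listed vertices up to `γ + iR`, then the
vertical ray from `γ + iR` to `γ + i∞`. -/
structure MBContour where
  γ : ℝ
  R : ℝ
  R_nonneg : 0 ≤ R
  vertices : List ℂ

/-- Integral of `f` along the segment from `a` to `b`. -/
def segIntegral (f : ℂ → ℂ) (a b : ℂ) : ℂ :=
  ∫ x in (0 : ℝ)..1, f (a + x * (b - a)) * (b - a)

/-- Integral of `f` along the broken line with the given successive nodes. -/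
def polyIntegral (f : ℂ → ℂ) : List ℂ → ℂ
  | a :: b :: l => segIntegral f a b + polyIntegral f (b :: l)
  | _ => 0

/-- The points of the broken line with the given successive nodes. -/
def polyCarrier : List ℂ → Set ℂ
  | a :: b :: l => segment ℝ a b ∪ polyCarrier (b :: l)
  | _ => ∅

namespace MBContour

/-- The nodes of the finite part of the contour. -/
def nodes (C : MBContour) : List ℂ :=
  ((C.γ : ℂ) - C.R * Complex.I) :: (C.vertices ++ [(C.γ : ℂ) + C.R * Complex.I])

/-- The points of the contour. -/
def carrier (C : MBContour) : Set ℂ :=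
  {s | ∃ y : ℝ, C.R ≤ |y| ∧ s = C.γ + y * Complex.I} ∪ polyCarrier C.nodes

/-- `∫_C f(s) ds`. -/
def integral (C : MBContour) (f : ℂ → ℂ) : ℂ :=
  (∫ y in Set.Iic (-C.R), f (C.γ + y * Complex.I) * Complex.I)
    + polyIntegral f C.nodes
    + ∫ y in Set.Ioi C.R, f (C.γ + y * Complex.I) * Complex.I

/-- The integral of `f` along `C` converges (absolutely) at both infinite ends. -/
def Converges (C : MBContour) (f : ℂ → ℂ) : Prop :=
  MeasureTheory.IntegrableOn (fun y : ℝ => f (C.γ + y * Complex.I)) (Set.Iic (-C.R)) ∧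
  MeasureTheory.IntegrableOn (fun y : ℝ => f (C.γ + y * Complex.I)) (Set.Ioi C.R)

/-- The integral of `f` along the part of `C` from `γ - iT` to `γ + iT` (for `T ≥ R`). -/
def truncIntegral (C : MBContour) (f : ℂ → ℂ) (T : ℝ) : ℂ :=
  (∫ y in (-T)..(-C.R), f (C.γ + y * Complex.I) * Complex.I)
    + polyIntegral f C.nodes
    + ∫ y in C.R..T, f (C.γ + y * Complex.I) * Complex.I

/-- `C` does not pass through `a`, and its index `(1 / 2πi) ∫_C ds / (s - a)` about `a`, as a
symmetric limit, is `w`. For a contour without self-intersections the index is `1/2` exactly when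
`a` lies on the left of `C`, and `-1/2` exactly when `a` lies on the right of `C`. -/
def HasIndex (C : MBContour) (a w : ℂ) : Prop :=
  a ∉ C.carrier ∧
  Filter.Tendsto
    (fun T : ℝ => (2 * Real.pi * Complex.I)⁻¹ * C.truncIntegral (fun s => (s - a)⁻¹) T)
    Filter.atTop (nhds w)

/-- `C` leaves all points of `L` on its left and all points of `P` on its right. -/
def Separates (C : MBContour) (L P : Set ℂ) : Prop :=
  (∀ a ∈ L, C.HasIndex a (1 / 2)) ∧ (∀ a ∈ P, C.HasIndex a (-1 / 2))

end MBContour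

/-- The quotient of products of Gamma functions in the Mellin-Barnes integral. Indices start at
`0`, so the first `m` lower pairs are those with `j < m`, the first `n` upper pairs those with
`j < n`. (At its poles `Complex.Gamma` takes the value `0`, so that a factor of the denominator
contributes the value `0` of the entire function `1 / Γ` there.) -/
def foxXi (m n : ℕ) {p q : ℕ} (α : Fin p → ℂ) (A : Fin p → ℝ) (β : Fin q → ℂ) (B : Fin q → ℝ)
    (s : ℂ) : ℂ :=
  ((∏ j ∈ Finset.univ.filter (fun j : Fin q => (j : ℕ) < m), Complex.Gamma (β j + B j * s)) *
    (∏ j ∈ Finset.univ.filter (fun j : Fin p => (j : ℕ) < n),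
      Complex.Gamma (1 - α j - A j * s))) /
  ((∏ j ∈ Finset.univ.filter (fun j : Fin q => m ≤ (j : ℕ)), Complex.Gamma (1 - β j - B j * s)) *
    (∏ j ∈ Finset.univ.filter (fun j : Fin p => n ≤ (j : ℕ)), Complex.Gamma (α j + A j * s)))

/-- The poles of `Γ(β_j + B_j s)`, `j = 1, …, m`. -/
def foxLeftPoles (m : ℕ) {q : ℕ} (β : Fin q → ℂ) (B : Fin q → ℝ) : Set ℂ :=
  {s | ∃ j : Fin q, (j : ℕ) < m ∧ ∃ l : ℕ, s = -(β j + l) / B j}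

/-- The poles of `Γ(1 - α_j - A_j s)`, `j = 1, …, n`. -/
def foxRightPoles (n : ℕ) {p : ℕ} (α : Fin p → ℂ) (A : Fin p → ℝ) : Set ℂ :=
  {s | ∃ j : Fin p, (j : ℕ) < n ∧ ∃ l : ℕ, s = (1 - α j + l) / A j}

/-- The condition that no pole of `Γ(β_j' + B_j' s)`, `j' = 1, …, m`, is a pole of
`Γ(1 - α_j - A_j s)`, `j = 1, …, n`. -/
def FoxPolesDistinct (m n : ℕ) {p q : ℕ} (α : Fin p → ℂ) (A : Fin p → ℝ) (β : Fin q → ℂ)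
    (B : Fin q → ℝ) : Prop :=
  ∀ j : Fin p, (j : ℕ) < n → ∀ j' : Fin q, (j' : ℕ) < m → ∀ l l' : ℕ,
    (A j : ℂ) * (l + β j') ≠ B j' * (α j - l' - 1)

/-- `C` is an admissible contour: it separates the poles of the two groups of Gamma functions. -/
def IsFoxContour (m n : ℕ) {p q : ℕ} (α : Fin p → ℂ) (A : Fin p → ℝ) (β : Fin q → ℂ)
    (B : Fin q → ℝ) (C : MBContour) : Prop :=
  C.Separates (foxLeftPoles m β B) (foxRightPoles n α A)

/-- The parameter `χ`. -/
def foxChi (m n : ℕ) {p q : ℕ} (A : Fin p → ℝ) (B : Fin q → ℝ) : ℝ :=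
  (∑ j ∈ Finset.univ.filter (fun j : Fin p => (j : ℕ) < n), A j)
    - (∑ j ∈ Finset.univ.filter (fun j : Fin p => n ≤ (j : ℕ)), A j)
    + (∑ j ∈ Finset.univ.filter (fun j : Fin q => (j : ℕ) < m), B j)
    - (∑ j ∈ Finset.univ.filter (fun j : Fin q => m ≤ (j : ℕ)), B j)

/-- The Mellin-Barnes integral at `z` exists: there is an admissible contour, and the integral
converges along each of them. -/
def FoxHExists (m n : ℕ) {p q : ℕ} (α : Fin p → ℂ) (A : Fin p → ℝ) (β : Fin q → ℂ)
    (B : Fin q → ℝ) (z : ℂ) : Prop :=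
  (∃ C : MBContour, IsFoxContour m n α A β B C) ∧
  ∀ C : MBContour, IsFoxContour m n α A β B C →
    C.Converges (fun s => foxXi m n α A β B s * z ^ (-s))

open Classical in
/-- The Fox `H`-function `H^{m,n}_{p,q}[z | (α_j, A_j); (β_j, B_j)]` for `χ > 0`: the integral
`(1 / 2πi) ∫_C Ξ(s) z^{-s} ds` along an admissible contour `C` from `γ - i∞` to `γ + i∞`.
By Cauchy's theorem the value does not depend on the contour. -/
def foxH (m n : ℕ) {p q : ℕ} (α : Fin p → ℂ) (A : Fin p → ℝ) (β : Fin q → ℂ) (B : Fin q → ℝ)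
    (z : ℂ) : ℂ :=
  if h : ∃ C : MBContour, IsFoxContour m n α A β B C then
    (2 * Real.pi * Complex.I)⁻¹ * h.choose.integral (fun s => foxXi m n α A β B s * z ^ (-s))
  else 0

end

/-! Prepending the pairs `(1 - ω_j, λ_j)` multiplies `Ξ` by `∏ Γ(ω_j - λ_j s)`. Where `λ Re s < ω`,
Euler's integral gives `Γ(ω - λ s) t^{-s} = ∫_0^∞ e^{-x} x^{ω-1} (t x^λ)^{-s} dx`. Inserting this
under the Mellin-Barnes integral and exchanging the integrals, each new factor replaces `H(t)` by
`∫_0^∞ e^{-x} x^{ω-1} H(t x^λ) dx`, an average of positive values with a positive weight. Induction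
over the factors (`integral_mul_prod_Gamma_pos`) gives the claim.

The exchange needs one contour that is admissible for both the old and the new function and stays in
`Re s ≤ c` with `λ_j c < ω_j` for all `j`. The left poles satisfy `Re s ≤ -min β_l / B_l < ω_j /
λ_j`, so there is room for `c` between them and the new poles. Old right poles may nevertheless lie
to the left of `c`, even among the left poles. The contour is therefore the vertical line through
`c` with a clockwise loop around each right pole on its left, which changes the index there from
`1/2` to `-1/2` (`exists_separating_contour`).

Since `foxH` uses an arbitrarily chosen contour, independence of the contour is needed as well
(`foxH_eq`). Contours are broken lines that may cross themselves, so no deformation is used. In a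
strip, `Ξ(s) t^{-s}` minus finitely many simple polar parts has a primitive
(`exists_primitive_sub_simple_poles`); the polar parts contribute equally because the indices agree,
and the endpoint terms of the primitive cancel in the limit because the integrand decays. The decay,
and with it convergence, follows from `|Γ(s)| = O(exp (-θ |Im s|))` in vertical strips for every `θ
< π/2`; summed over all factors, the rate is `χ π / 2`. -/

open Filter Topology MeasureTheory Set

/-! ### Integration along broken lines. -/

section Polyline

theorem segment_subset_polyCarrier_cons (a b : ℂ) (l : List ℂ) :
    segment ℝ a b ⊆ polyCarrier (a :: b :: l) := by
  rw [polyCarrier]; exact subset_union_left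

theorem polyCarrier_tail_subset (a b : ℂ) (l : List ℂ) :
    polyCarrier (b :: l) ⊆ polyCarrier (a :: b :: l) := by
  conv_rhs => rw [polyCarrier]
  exact subset_union_right

theorem add_mul_sub_mem_segment {a b : ℂ} {x : ℝ} (hx : x ∈ Icc (0 : ℝ) 1) :
    a + x * (b - a) ∈ segment ℝ a b := by
  rw [segment_eq_image']
  exact ⟨x, hx, by simp⟩

theorem isCompact_polyCarrier : ∀ l : List ℂ, IsCompact (polyCarrier l)
  | [] => by simp [polyCarrier]
  | [_] => by simp [polyCarrier]
  | a :: b :: l => by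
    rw [polyCarrier]
    refine IsCompact.union ?_ (isCompact_polyCarrier (b :: l))
    rw [segment_eq_image']
    exact isCompact_Icc.image (by fun_prop)

theorem continuousOn_comp_lineMap {F : ℂ → ℂ} {a b : ℂ} (hF : ContinuousOn F (segment ℝ a b)) :
    ContinuousOn (fun x : ℝ => F (a + x * (b - a))) (Icc 0 1) :=
  hF.comp (by fun_prop) fun _ hx => add_mul_sub_mem_segment hx

theorem intervalIntegrable_segment {F : ℂ → ℂ} {a b : ℂ} (hF : ContinuousOn F (segment ℝ a b)) :
    IntervalIntegrable (fun x : ℝ => F (a + x * (b - a)) * (b - a)) volume 0 1 := by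
  apply ContinuousOn.intervalIntegrable
  rw [uIcc_of_le zero_le_one]
  exact (continuousOn_comp_lineMap hF).mul continuousOn_const

theorem segIntegral_eq_sub {F G : ℂ → ℂ} {a b : ℂ} (hF : ContinuousOn F (segment ℝ a b))
    (hG : ∀ s ∈ segment ℝ a b, HasDerivAt G (F s) s) : segIntegral F a b = G b - G a := by
  unfold segIntegral
  rw [intervalIntegral.integral_eq_sub_of_hasDerivAt
    (f := fun x : ℝ => G (a + x * (b - a))) _ (intervalIntegrable_segment hF)]
  · simp
  · intro x hx
    rw [uIcc_of_le zero_le_one] at hx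
    have h1 : HasDerivAt (fun x : ℝ => a + x * (b - a)) (b - a) x := by
      simpa using ((Complex.ofRealCLM.hasDerivAt (x := x)).mul_const (b - a)).const_add a
    exact (hG _ (add_mul_sub_mem_segment hx)).comp x h1

theorem polyIntegral_eq_sub {F G : ℂ → ℂ} (b : ℂ) : ∀ (l : List ℂ) (a : ℂ),
    ContinuousOn F (polyCarrier (a :: (l ++ [b]))) →
    (∀ s ∈ polyCarrier (a :: (l ++ [b])), HasDerivAt G (F s) s) →
    polyIntegral F (a :: (l ++ [b])) = G b - G a
  | [], a, hF, hG => by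
    simp only [List.nil_append, polyIntegral, add_zero] at *
    exact segIntegral_eq_sub (hF.mono (segment_subset_polyCarrier_cons _ _ _))
      fun s hs => hG s (segment_subset_polyCarrier_cons _ _ _ hs)
  | c :: l, a, hF, hG => by
    simp only [List.cons_append, polyIntegral] at *
    rw [polyIntegral_eq_sub b l c (hF.mono (polyCarrier_tail_subset _ _ _))
      fun s hs => hG s (polyCarrier_tail_subset _ _ _ hs),
      segIntegral_eq_sub (hF.mono (segment_subset_polyCarrier_cons _ _ _))
      fun s hs => hG s (segment_subset_polyCarrier_cons _ _ _ hs)]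
    ring

theorem segIntegral_add {F G : ℂ → ℂ} {a b : ℂ} (hF : ContinuousOn F (segment ℝ a b))
    (hG : ContinuousOn G (segment ℝ a b)) :
    segIntegral (fun s => F s + G s) a b = segIntegral F a b + segIntegral G a b := by
  unfold segIntegral
  rw [← intervalIntegral.integral_add (intervalIntegrable_segment hF)
    (intervalIntegrable_segment hG)]
  simp only [add_mul]

theorem segIntegral_const_mul (c : ℂ) (F : ℂ → ℂ) (a b : ℂ) :
    segIntegral (fun s => c * F s) a b = c * segIntegral F a b := by
  unfold segIntegral
  simp only [mul_assoc, intervalIntegral.integral_const_mul]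

theorem polyIntegral_add {F G : ℂ → ℂ} : ∀ l : List ℂ, ContinuousOn F (polyCarrier l) →
    ContinuousOn G (polyCarrier l) →
    polyIntegral (fun s => F s + G s) l = polyIntegral F l + polyIntegral G l
  | [], _, _ => by simp [polyIntegral]
  | [_], _, _ => by simp [polyIntegral]
  | a :: b :: l, hF, hG => by
    simp only [polyIntegral]
    rw [polyIntegral_add (b :: l) (hF.mono (polyCarrier_tail_subset _ _ _))
      (hG.mono (polyCarrier_tail_subset _ _ _)),
      segIntegral_add (hF.mono (segment_subset_polyCarrier_cons _ _ _))
      (hG.mono (segment_subset_polyCarrier_cons _ _ _))]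
    ring

theorem polyIntegral_const_mul (c : ℂ) (F : ℂ → ℂ) : ∀ l : List ℂ,
    polyIntegral (fun s => c * F s) l = c * polyIntegral F l
  | [] => by simp [polyIntegral]
  | [_] => by simp [polyIntegral]
  | a :: b :: l => by
    simp only [polyIntegral, polyIntegral_const_mul c F (b :: l), segIntegral_const_mul, mul_add]

end Polyline

/-! ### Truncated and full integrals along a contour. -/

namespace MBContour

variable {C : MBContour} {F G : ℂ → ℂ} {T : ℝ}

theorem ray_mem_carrier {y : ℝ} (hy : C.R ≤ |y|) : (C.γ : ℂ) + y * Complex.I ∈ C.carrier :=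
  Or.inl ⟨y, hy, rfl⟩

theorem polyCarrier_subset_carrier : polyCarrier C.nodes ⊆ C.carrier := subset_union_right

/-- The rays have constant real part and the finite part is compact. Working in a strip matters
because it contains only finitely many poles. -/
theorem exists_abs_re_lt (C : MBContour) : ∃ M : ℝ, ∀ s ∈ C.carrier, |s.re| < M := by
  obtain ⟨K, hK⟩ := (isCompact_polyCarrier C.nodes).isBounded.exists_norm_le
  refine ⟨max K |C.γ| + 1, ?_⟩
  rintro s (⟨y, -, rfl⟩ | hs)
  · simpa using (le_max_right K |C.γ|).trans_lt (lt_add_one _)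
  · exact ((Complex.abs_re_le_norm s).trans ((hK s hs).trans (le_max_left _ _))).trans_lt
      (lt_add_one _)

theorem abs_ge_of_mem_upper (C : MBContour) (hT : C.R ≤ T) {y : ℝ} (hy : y ∈ uIcc C.R T) :
    C.R ≤ |y| := by
  rw [uIcc_of_le hT] at hy
  exact hy.1.trans (le_abs_self y)

theorem abs_ge_of_mem_lower (C : MBContour) (hT : C.R ≤ T) {y : ℝ} (hy : y ∈ uIcc (-T) (-C.R)) :
    C.R ≤ |y| := by
  rw [uIcc_of_le (neg_le_neg hT)] at hy
  exact (le_neg.1 hy.2).trans (neg_le_abs y)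

theorem continuousOn_ray (hF : ContinuousOn F C.carrier) :
    ContinuousOn (fun y : ℝ => F (C.γ + y * Complex.I)) {y | C.R ≤ |y|} :=
  hF.comp (by fun_prop) fun _ hy => ray_mem_carrier hy

theorem intervalIntegrable_upper (hF : ContinuousOn F C.carrier) (hT : C.R ≤ T) :
    IntervalIntegrable (fun y : ℝ => F (C.γ + y * Complex.I) * Complex.I) volume C.R T :=
  (((continuousOn_ray hF).mono fun _ hy => C.abs_ge_of_mem_upper hT hy).mul
    continuousOn_const).intervalIntegrable

theorem intervalIntegrable_lower (hF : ContinuousOn F C.carrier) (hT : C.R ≤ T) :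
    IntervalIntegrable (fun y : ℝ => F (C.γ + y * Complex.I) * Complex.I) volume (-T) (-C.R) :=
  (((continuousOn_ray hF).mono fun _ hy => C.abs_ge_of_mem_lower hT hy).mul
    continuousOn_const).intervalIntegrable

theorem truncIntegral_eq_sub (hF : ContinuousOn F C.carrier)
    (hG : ∀ s ∈ C.carrier, HasDerivAt G (F s) s) (hT : C.R ≤ T) :
    C.truncIntegral F T = G (C.γ + T * Complex.I) - G (C.γ - T * Complex.I) := by
  have hray (y : ℝ) (hy : C.R ≤ |y|) : HasDerivAt (fun y : ℝ => G (C.γ + y * Complex.I))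
      (F (C.γ + y * Complex.I) * Complex.I) y := by
    have h1 : HasDerivAt (fun y : ℝ => (C.γ : ℂ) + y * Complex.I) Complex.I y := by
      simpa using ((Complex.ofRealCLM.hasDerivAt (x := y)).mul_const Complex.I).const_add (C.γ : ℂ)
    exact (hG _ (ray_mem_carrier hy)).comp y h1
  unfold truncIntegral nodes
  rw [intervalIntegral.integral_eq_sub_of_hasDerivAt
      (fun y hy => hray y (C.abs_ge_of_mem_upper hT hy)) (intervalIntegrable_upper hF hT),
    intervalIntegral.integral_eq_sub_of_hasDerivAt
      (fun y hy => hray y (C.abs_ge_of_mem_lower hT hy)) (intervalIntegrable_lower hF hT),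
    polyIntegral_eq_sub (G := G) _ _ _ (hF.mono polyCarrier_subset_carrier)
      fun s hs => hG s (polyCarrier_subset_carrier hs)]
  push_cast
  simp only [neg_mul, ← sub_eq_add_neg]
  ring

theorem truncIntegral_add (hF : ContinuousOn F C.carrier) (hG : ContinuousOn G C.carrier)
    (hT : C.R ≤ T) :
    C.truncIntegral (fun s => F s + G s) T = C.truncIntegral F T + C.truncIntegral G T := by
  unfold truncIntegral
  rw [polyIntegral_add _ (hF.mono polyCarrier_subset_carrier)
    (hG.mono polyCarrier_subset_carrier)]
  simp only [add_mul]
  rw [intervalIntegral.integral_add (intervalIntegrable_upper hF hT)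
    (intervalIntegrable_upper hG hT), intervalIntegral.integral_add
    (intervalIntegrable_lower hF hT) (intervalIntegrable_lower hG hT)]
  ring

theorem truncIntegral_const_mul (C : MBContour) (c : ℂ) (F : ℂ → ℂ) (T : ℝ) :
    C.truncIntegral (fun s => c * F s) T = c * C.truncIntegral F T := by
  unfold truncIntegral
  rw [polyIntegral_const_mul]
  simp only [mul_assoc, intervalIntegral.integral_const_mul]
  ring

theorem truncIntegral_sum {Z : Finset ℂ} {f : ℂ → ℂ → ℂ}
    (hf : ∀ a ∈ Z, ContinuousOn (f a) C.carrier) (hT : C.R ≤ T) :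
    C.truncIntegral (fun s => ∑ a ∈ Z, f a s) T = ∑ a ∈ Z, C.truncIntegral (f a) T := by
  induction Z using Finset.cons_induction with
  | empty => simpa using C.truncIntegral_const_mul 0 0 T
  | cons a Z ha ih =>
    simp only [Finset.sum_cons]
    rw [truncIntegral_add (hf a (by simp))
      (continuousOn_finsetSum _ fun b hb => hf b (by simp [hb])) hT,
      ih fun b hb => hf b (by simp [hb])]

theorem tendsto_truncIntegral (h : C.Converges F) :
    Tendsto (C.truncIntegral F) atTop (𝓝 (C.integral F)) := by
  unfold integral
  change Tendsto (fun T => C.truncIntegral F T) _ _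
  unfold truncIntegral
  refine (Tendsto.add ?_ tendsto_const_nhds).add ?_
  · exact intervalIntegral_tendsto_integral_Iic _ (h.1.mul_const _) tendsto_neg_atTop_atBot
  · exact intervalIntegral_tendsto_integral_Ioi _ (h.2.mul_const _) tendsto_id

end MBContour

/-! ### Primitives modulo simple polar parts. -/

section Primitive

/-- Adds one pole `a` to the set `Z`, by induction on a bound `n` for its order: the leading polar
term is split off, and only a term of order one fails to have a primitive. -/
theorem exists_primitive_sub_simple_pole {U : Set ℂ} {Z : Finset ℂ} {a : ℂ}
    (hU : IsOpen U) (ha : a ∉ Z)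
    (ih : ∀ F : ℂ → ℂ, DifferentiableOn ℂ F (U \ Z) → (∀ b ∈ Z, MeromorphicAt F b) →
      ∃ r G : ℂ → ℂ, ∀ s ∈ U \ Z, HasDerivAt G (F s - ∑ b ∈ Z, r b / (s - b)) s) (n : ℕ) :
    ∀ F h : ℂ → ℂ, DifferentiableOn ℂ F (U \ insert a Z) → (∀ b ∈ Z, MeromorphicAt F b) →
      AnalyticAt ℂ h a → (∀ᶠ s in 𝓝[≠] a, F s = h s / (s - a) ^ n) →
      ∃ r G : ℂ → ℂ, ∀ s ∈ U \ insert a Z,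
        HasDerivAt G (F s - (r a / (s - a) + ∑ b ∈ Z, r b / (s - b))) s := by
  classical
  have hopen : IsOpen (U \ insert a (Z : Set ℂ)) :=
    hU.sdiff (by simp)
  induction n with
  | zero =>
    intro F h hF hFm hh hFh
    -- The singularity is removable: corrected at `a`, the function is holomorphic there and `ih`
    -- applies.
    have hupd : Function.update F a (h a) =ᶠ[𝓝 a] h := by
      rw [eventually_nhdsWithin_iff] at hFh
      filter_upwards [hFh] with s hs
      rcases eq_or_ne s a with rfl | hsa
      · simp
      · simpa [hsa] using hs hsa
    have heq {s : ℂ} (hs : s ≠ a) : Function.update F a (h a) =ᶠ[𝓝 s] F := by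
      filter_upwards [isOpen_ne.mem_nhds hs] with w hw
      rw [Function.update_of_ne hw]
    obtain ⟨r, G, hG⟩ := ih (Function.update F a (h a)) (by
      intro s hs
      rcases eq_or_ne s a with rfl | hsa
      · exact (hh.differentiableAt.congr_of_eventuallyEq hupd).differentiableWithinAt
      · have : s ∈ U \ insert a (Z : Set ℂ) := ⟨hs.1, by simpa [hsa] using hs.2⟩
        exact (((hF s this).differentiableAt
          (hopen.mem_nhds this)).congr_of_eventuallyEq (heq hsa)).differentiableWithinAt)
      (fun b hb => (hFm b hb).update _ _)
    refine ⟨Function.update r a 0, G, fun s hs => ?_⟩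
    have hsa : s ≠ a := fun h => hs.2 (by simp [h])
    have := hG s ⟨hs.1, fun h => hs.2 (Or.inr h)⟩
    rw [Function.update_of_ne hsa] at this
    convert this using 2
    rw [Function.update_self, zero_div, zero_add]
    refine Finset.sum_congr rfl fun b hb => ?_
    rw [Function.update_of_ne (by rintro rfl; exact ha hb)]
  | succ n IH =>
    intro F h hF hFm hh hFh
    have hne : ∀ s ∈ U \ insert a (Z : Set ℂ), s - a ≠ 0 :=
      fun s hs h0 => hs.2 (Or.inl (sub_eq_zero.1 h0))
    -- The difference is `((h s - h a) / (s - a)) / (s - a) ^ n`, whose numerator extends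
    -- analytically as `dslope h a`.
    obtain ⟨r, G, hG⟩ := IH (fun s => F s - h a / (s - a) ^ (n + 1)) (dslope h a)
      (by
        refine hF.sub (DifferentiableOn.div (by fun_prop) (by fun_prop) ?_)
        exact fun s hs => pow_ne_zero _ (hne s hs))
      (fun b hb => by
        have := hFm b hb
        have h2 : MeromorphicAt (fun s : ℂ => h a / (s - a) ^ (n + 1)) b := by fun_prop
        exact this.sub h2)
      (by
        obtain ⟨p, hp⟩ := hh
        exact ⟨_, hp.has_fpower_series_dslope_fslope⟩)
      (by
        filter_upwards [hFh, self_mem_nhdsWithin] with s hs hsa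
        have : s - a ≠ 0 := sub_ne_zero.2 hsa
        rw [hs, dslope_of_ne _ hsa, slope_def_field, pow_succ]
        field_simp)
    -- The term removed has order `n + 1`: for `n = 0` it joins the residue, otherwise it has the
    -- primitive `-h a / (n (s - a) ^ n)`.
    rcases Nat.eq_zero_or_pos n with rfl | hn
    · refine ⟨Function.update r a (r a + h a), G, fun s hs => ?_⟩
      have := hG s hs
      convert this using 1
      have hsum : ∑ b ∈ Z, Function.update r a (r a + h a) b / (s - b)
          = ∑ b ∈ Z, r b / (s - b) := by
        refine Finset.sum_congr rfl fun b hb => ?_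
        rw [Function.update_of_ne (by rintro rfl; exact ha hb)]
      rw [hsum, Function.update_self]
      ring
    · refine ⟨r, fun s => G s + h a * (-(1 / n : ℂ) * ((s - a) ^ n)⁻¹), fun s hs => ?_⟩
      have hs0 := hne s hs
      have hn' : (n : ℂ) ≠ 0 := by exact_mod_cast hn.ne'
      have h1 : HasDerivAt (fun s : ℂ => (s - a) ^ n) (n * (s - a) ^ (n - 1) * 1) s :=
        ((hasDerivAt_id s).sub_const a).pow n
      have h2 := ((h1.inv (pow_ne_zero n hs0)).const_mul (-(1 / n : ℂ))).const_mul (h a)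
      refine ((hG s hs).add h2).congr_deriv ?_
      have : (s - a) ^ n = (s - a) ^ (n - 1) * (s - a) := by
        rw [← pow_succ, Nat.sub_add_cancel hn]
      have hp := pow_ne_zero (n - 1) hs0
      rw [pow_succ, this]
      field_simp
      ring

/-- On a convex open set, a function with finitely many poles differs from the derivative of a
function by a sum of simple polar parts. -/
theorem exists_primitive_sub_simple_poles {U : Set ℂ} (hU : IsOpen U) (hUc : Convex ℝ U)
    (Z : Finset ℂ) : ∀ F : ℂ → ℂ, DifferentiableOn ℂ F (U \ Z) → (∀ b ∈ Z, MeromorphicAt F b) →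
      ∃ r G : ℂ → ℂ, ∀ s ∈ U \ Z, HasDerivAt G (F s - ∑ b ∈ Z, r b / (s - b)) s := by
  induction Z using Finset.cons_induction with
  | empty =>
    intro F hF _
    obtain ⟨G, hG⟩ := hUc.exists_forall_hasDerivWithinAt (f := F) (by simpa using hF)
    exact ⟨0, G, fun s hs => by simpa using (hG s hs.1).hasDerivAt (hU.mem_nhds hs.1)⟩
  | cons a Z ha ih =>
    intro F hF hFm
    obtain ⟨n, hn⟩ := hFm a (by simp)
    simp only [Finset.coe_cons] at hF ⊢
    simp only [Finset.sum_cons]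
    refine exists_primitive_sub_simple_pole hU ha ih n F _ hF
      (fun b hb => hFm b (by simp [hb])) hn ?_
    filter_upwards [self_mem_nhdsWithin] with s hs
    have : s - a ≠ 0 := sub_ne_zero.2 hs
    simp only [smul_eq_mul]
    field_simp

end Primitive

/-! ### Cauchy's theorem: independence of the contour. -/

section Independence

theorem convex_reProdIm {s t : Set ℝ} (hs : Convex ℝ s) (ht : Convex ℝ t) : Convex ℝ (s ×ℂ t) :=
  (hs.linear_preimage Complex.reLm).inter (ht.linear_preimage Complex.imLm)

/-- The filter `|Im s| → ∞` in the strip `|Re s| ≤ M`. -/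
def stripFilter (M : ℝ) : Filter ℂ :=
  comap (fun s => |s.im|) atTop ⊓ 𝓟 {s | |s.re| ≤ M}

theorem eventually_stripFilter {M : ℝ} {p : ℂ → Prop} :
    (∀ᶠ s in stripFilter M, p s) ↔ ∃ Y : ℝ, ∀ s : ℂ, |s.re| ≤ M → Y ≤ |s.im| → p s := by
  rw [stripFilter, eventually_inf_principal, eventually_comap, eventually_atTop]
  constructor
  · rintro ⟨Y, hY⟩
    exact ⟨Y, fun s hs hs' => hY _ hs' s rfl hs⟩
  · rintro ⟨Y, hY⟩
    exact ⟨Y, fun b hb s hs hs' => hY s hs' (hs ▸ hb)⟩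

theorem tendsto_inv_sub_stripFilter (a : ℂ) (M : ℝ) :
    Tendsto (fun s : ℂ => (s - a)⁻¹) (stripFilter M) (𝓝 0) := by
  refine tendsto_inv₀_cobounded.comp (tendsto_norm_atTop_iff_cobounded.1 ?_)
  rw [tendsto_atTop]
  intro K
  rw [eventually_stripFilter]
  refine ⟨K + |a.im|, fun s _ hs => ?_⟩
  have h1 := Complex.abs_im_le_norm (s - a)
  have h2 := abs_sub_abs_le_abs_sub s.im a.im
  rw [Complex.sub_im] at h1
  linarith

/-- Mean value inequality on a horizontal segment of length at most `2 * M`, at a height where the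
derivative is small. It compares the endpoints of two truncated contours with different `γ`. -/
theorem tendsto_sub_of_tendsto_deriv {M γ₁ γ₂ : ℝ} {G H : ℂ → ℂ} {σ : ℝ → ℝ}
    (hσ : Tendsto (fun T => |σ T|) atTop atTop)
    (h1 : |γ₁| ≤ M) (h2 : |γ₂| ≤ M) (hG : ∀ᶠ s in stripFilter M, HasDerivAt G (H s) s)
    (hH : Tendsto H (stripFilter M) (𝓝 0)) :
    Tendsto (fun T : ℝ => G (γ₁ + σ T * Complex.I) - G (γ₂ + σ T * Complex.I)) atTop (𝓝 0) := by
  rw [Metric.tendsto_nhds]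
  intro ε hε
  have hM : 0 ≤ M := (abs_nonneg _).trans h1
  have hε' : 0 < ε / (2 * M + 1) := by positivity
  obtain ⟨Y, hY⟩ := eventually_stripFilter.1 (hG.and (Metric.tendsto_nhds.1 hH _ hε'))
  filter_upwards [hσ.eventually_ge_atTop Y] with T hT
  have hsub : ∀ s : ℂ, s ∈ Icc (-M) M ×ℂ {σ T} → |s.re| ≤ M ∧ Y ≤ |s.im| := by
    intro s hs
    rw [Complex.mem_reProdIm, mem_singleton_iff] at hs
    exact ⟨abs_le.2 hs.1, hs.2 ▸ hT⟩
  have hmem {γ : ℝ} (h : |γ| ≤ M) : (γ + σ T * Complex.I : ℂ) ∈ Icc (-M) M ×ℂ {σ T} := by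
    rw [Complex.mem_reProdIm]
    simpa using abs_le.1 h
  have hconv : Convex ℝ (Icc (-M) M ×ℂ {σ T}) := convex_reProdIm (convex_Icc _ _) (convex_singleton _)
  have key := hconv.norm_image_sub_le_of_norm_hasDerivWithin_le (f := G) (f' := H)
    (C := ε / (2 * M + 1)) (fun s hs => ((hY s (hsub s hs).1 (hsub s hs).2).1).hasDerivWithinAt)
    (fun s hs => by simpa using ((hY s (hsub s hs).1 (hsub s hs).2).2).le) (hmem h2) (hmem h1)
  rw [dist_zero_right]
  refine key.trans_lt ?_
  have : ‖((γ₁ : ℂ) + σ T * Complex.I) - (γ₂ + σ T * Complex.I)‖ ≤ 2 * M := by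
    rw [add_sub_add_right_eq_sub, ← Complex.ofReal_sub, Complex.norm_real, Real.norm_eq_abs]
    linarith [abs_sub γ₁ γ₂]
  calc _ ≤ ε / (2 * M + 1) * (2 * M) := by gcongr
    _ < ε / (2 * M + 1) * (2 * M + 1) := by gcongr; linarith
    _ = ε := by field_simp

/-- Cauchy's theorem: the integral does not depend on the contour, as long as the indices about
the poles do not change. -/
theorem MBContour.integral_eq_integral {F : ℂ → ℂ} {Z : Set ℂ} {C₁ C₂ : MBContour}
    (hfin : ∀ M : ℝ, (Z ∩ {s | |s.re| ≤ M}).Finite)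
    (hd : ∀ s ∉ Z, DifferentiableAt ℂ F s) (hm : ∀ a, MeromorphicAt F a)
    (hF : ∀ M, Tendsto F (stripFilter M) (𝓝 0))
    (h₁ : C₁.Converges F) (h₂ : C₂.Converges F)
    (hI : ∀ a ∈ Z, ∃ w, C₁.HasIndex a w ∧ C₂.HasIndex a w) :
    C₁.integral F = C₂.integral F := by
  obtain ⟨M₁, hM₁⟩ := C₁.exists_abs_re_lt
  obtain ⟨M₂, hM₂⟩ := C₂.exists_abs_re_lt
  set M := max M₁ M₂
  set U : Set ℂ := {s | |s.re| < M} with hU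
  have hc₁ : C₁.carrier ⊆ U := fun s hs => (hM₁ s hs).trans_le (le_max_left _ _)
  have hc₂ : C₂.carrier ⊆ U := fun s hs => (hM₂ s hs).trans_le (le_max_right _ _)
  -- The strip is widened by one so that its open version `V` contains the closed strip `|Re s| ≤ M`
  -- used by `stripFilter M`.
  set P := (hfin (M + 1)).toFinset with hP
  have hPZ : ∀ a ∈ P, a ∈ Z := fun a ha => by simp [hP] at ha; exact ha.1
  have hnP : ∀ s, |s.re| ≤ M + 1 → s ∉ P → s ∉ Z := fun s hs hsP hsZ =>
    hsP (by simp [hP]; exact ⟨hsZ, hs⟩)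
  set V : Set ℂ := {s | |s.re| < M + 1} with hV
  have hVo : IsOpen V := isOpen_lt (by fun_prop) continuous_const
  have hVc : Convex ℝ V := by
    have : V = Ioo (-(M + 1)) (M + 1) ×ℂ univ := by
      ext s; simp only [hV, Complex.mem_reProdIm, mem_Ioo, mem_univ, abs_lt, mem_ofPred_eq, and_true]
    rw [this]
    exact convex_reProdIm (convex_Ioo _ _) convex_univ
  have hUV : U ⊆ V := fun s hs => lt_trans (show |s.re| < M from hs) (lt_add_one M)
  obtain ⟨r, G, hG⟩ := exists_primitive_sub_simple_poles hVo hVc P F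
    (fun s hs => (hd s (hnP s (le_of_lt hs.1) (by simpa using hs.2))).differentiableWithinAt)
    (fun b _ => hm b)
  have htrunc {C : MBContour} (hCU : C.carrier ⊆ U) (hCP : ∀ a ∈ P, a ∉ C.carrier) {T : ℝ}
      (hT : C.R ≤ T) : C.truncIntegral F T = G (C.γ + T * Complex.I) - G (C.γ - T * Complex.I)
        + ∑ a ∈ P, r a * C.truncIntegral (fun s => (s - a)⁻¹) T := by
    have hmem : ∀ s ∈ C.carrier, s ∈ V \ P := fun s hs =>
      ⟨hUV (hCU hs), fun h => hCP s (by simpa using h) hs⟩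
    have hinv : ∀ a ∈ P, ContinuousOn (fun s : ℂ => r a * (s - a)⁻¹) C.carrier := fun a ha =>
      continuousOn_const.mul (ContinuousOn.inv₀ (by fun_prop) fun s hs h0 =>
        hCP a ha (sub_eq_zero.1 h0 ▸ hs))
    have hFc : ContinuousOn F C.carrier := fun s hs => (hd s (hnP s
      (le_of_lt (hmem s hs).1) (by simpa using (hmem s hs).2))).continuousAt.continuousWithinAt
    have hsum : ContinuousOn (fun s : ℂ => ∑ a ∈ P, r a * (s - a)⁻¹) C.carrier :=
      continuousOn_finsetSum _ hinv
    have e : F = fun s => (F s - ∑ a ∈ P, r a * (s - a)⁻¹) + ∑ a ∈ P, r a * (s - a)⁻¹ := by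
      ext s; ring
    conv_lhs => rw [e]
    rw [truncIntegral_add (F := fun s => F s - ∑ a ∈ P, r a * (s - a)⁻¹) (hFc.sub hsum) hsum hT, truncIntegral_sum hinv hT,
      truncIntegral_eq_sub (F := fun s => F s - ∑ a ∈ P, r a * (s - a)⁻¹) (hFc.sub hsum) (G := G) _ hT]
    · simp only [truncIntegral_const_mul]
    · exact fun s hs => by simpa only [div_eq_mul_inv] using hG s (hmem s hs)
  have hav₁ : ∀ a ∈ P, a ∉ C₁.carrier := fun a ha => by
    obtain ⟨w, h, -⟩ := hI a (hPZ a ha); exact h.1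
  have hav₂ : ∀ a ∈ P, a ∉ C₂.carrier := fun a ha => by
    obtain ⟨w, -, h⟩ := hI a (hPZ a ha); exact h.1
  have hlim := (MBContour.tendsto_truncIntegral h₁).sub (MBContour.tendsto_truncIntegral h₂)
  rw [← sub_eq_zero]
  refine tendsto_nhds_unique hlim ?_
  have hγ₁ : |C₁.γ| ≤ M := by
    have := hc₁ (C₁.ray_mem_carrier (le_abs_self C₁.R))
    simp [hU] at this; exact this.le
  have hγ₂ : |C₂.γ| ≤ M := by
    have := hc₂ (C₂.ray_mem_carrier (le_abs_self C₂.R))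
    simp [hU] at this; exact this.le
  -- The sum of all `|Im b|` plus one is a height above every pole in `P`.
  have hGs : ∀ᶠ s in stripFilter M, HasDerivAt G (F s - ∑ b ∈ P, r b / (s - b)) s := by
    rw [eventually_stripFilter]
    refine ⟨∑ b ∈ P, |b.im| + 1, fun s hs hs' => hG s ⟨lt_of_le_of_lt hs (lt_add_one M), ?_⟩⟩
    intro hsP
    have := Finset.single_le_sum (f := fun b : ℂ => |b.im|) (fun _ _ => abs_nonneg _)
      (Finset.mem_coe.1 hsP)
    linarith
  have hHs : Tendsto (fun s => F s - ∑ b ∈ P, r b / (s - b)) (stripFilter M) (𝓝 0) := by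
    have : Tendsto (fun s => ∑ b ∈ P, r b / (s - b)) (stripFilter M) (𝓝 (∑ b ∈ P, r b * 0)) :=
      tendsto_finsetSum _ fun b _ => by
        simpa only [div_eq_mul_inv] using
          (tendsto_inv_sub_stripFilter b M).const_mul (r b)
    simpa using (hF M).sub this
  have hup := tendsto_sub_of_tendsto_deriv (σ := fun T => T) tendsto_abs_atTop_atTop
    hγ₁ hγ₂ hGs hHs
  have hlo := tendsto_sub_of_tendsto_deriv (σ := fun T => -T)
    (by simpa using tendsto_abs_atTop_atTop) hγ₁ hγ₂ hGs hHs
  -- The equal indices enter here: the contribution of each residue tends to `2πi r_a (w - w) = 0`.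
  have hidx : Tendsto (fun T => ∑ a ∈ P, r a * (C₁.truncIntegral (fun s => (s - a)⁻¹) T
      - C₂.truncIntegral (fun s => (s - a)⁻¹) T)) atTop (𝓝 (∑ a ∈ P, r a * 0)) := by
    refine tendsto_finsetSum _ fun a ha => Tendsto.const_mul _ ?_
    obtain ⟨w, hw₁, hw₂⟩ := hI a (hPZ a ha)
    have := ((hw₁.2.sub hw₂.2).const_mul (2 * Real.pi * Complex.I))
    rw [sub_self, mul_zero] at this
    refine this.congr fun T => ?_
    rw [← mul_sub, mul_inv_cancel_left₀ Complex.two_pi_I_ne_zero]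
  have hall := (hup.sub hlo).add hidx
  simp only [mul_zero, Finset.sum_const_zero, sub_zero, add_zero] at hall
  refine hall.congr' ?_
  filter_upwards [eventually_ge_atTop C₁.R, eventually_ge_atTop C₂.R] with T hT₁ hT₂
  rw [htrunc hc₁ hav₁ hT₁, htrunc hc₂ hav₂ hT₂]
  simp only [mul_sub, Finset.sum_sub_distrib, Complex.ofReal_neg, neg_mul, ← sub_eq_add_neg]
  ring

end Independence

/-! ### Concatenation of broken lines. -/

section PolylineAppend

theorem polyIntegral_append (F : ℂ → ℂ) (x : ℂ) (v : List ℂ) : ∀ u : List ℂ,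
    polyIntegral F (u ++ x :: v) = polyIntegral F (u ++ [x]) + polyIntegral F (x :: v)
  | [] => by simp [polyIntegral]
  | [a] => by simp [polyIntegral]
  | a :: b :: u => by
    have := polyIntegral_append F x v (b :: u)
    simp only [List.cons_append, polyIntegral] at this ⊢
    rw [this, add_assoc]

theorem polyCarrier_append (x : ℂ) (v : List ℂ) : ∀ u : List ℂ,
    polyCarrier (u ++ x :: v) = polyCarrier (u ++ [x]) ∪ polyCarrier (x :: v)
  | [] => by simp [polyCarrier]
  | [a] => by simp [polyCarrier]
  | a :: b :: u => by
    have := polyCarrier_append x v (b :: u)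
    simp only [List.cons_append, polyCarrier] at this ⊢
    rw [this, union_assoc]

theorem re_im_mem_of_mem_segment {u v s : ℂ} (hs : s ∈ segment ℝ u v) :
    s.re ∈ uIcc u.re v.re ∧ s.im ∈ uIcc u.im v.im := by
  have : Convex ℝ (uIcc u.re v.re ×ℂ uIcc u.im v.im) :=
    convex_reProdIm (convex_uIcc _ _) (convex_uIcc _ _)
  exact this.segment_subset (Complex.mem_reProdIm.2 ⟨left_mem_uIcc, left_mem_uIcc⟩)
    (Complex.mem_reProdIm.2 ⟨right_mem_uIcc, right_mem_uIcc⟩) hs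

end PolylineAppend

/-! ### Branches of the logarithm as primitives of `1 / (s - a)`. -/

section Log

theorem hasDerivAt_log_sub {a s : ℂ} (h : s - a ∈ Complex.slitPlane) :
    HasDerivAt (fun s => Complex.log (s - a)) (s - a)⁻¹ s := by
  simpa using ((hasDerivAt_id s).sub_const a).clog h

theorem hasDerivAt_log_sub' {a s : ℂ} (h : a - s ∈ Complex.slitPlane) :
    HasDerivAt (fun s => Complex.log (a - s)) (s - a)⁻¹ s := by
  have := ((hasDerivAt_id s).const_sub a).clog h
  simp only [id_eq] at this
  rwa [neg_div, ← div_neg, neg_sub, one_div] at this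

theorem segIntegral_inv_sub {a u v : ℂ} (h : ∀ s ∈ segment ℝ u v, s - a ∈ Complex.slitPlane) :
    segIntegral (fun s => (s - a)⁻¹) u v = Complex.log (v - a) - Complex.log (u - a) :=
  segIntegral_eq_sub (G := fun s => Complex.log (s - a)) (ContinuousOn.inv₀ (by fun_prop)
    fun s hs => Complex.slitPlane_ne_zero (h s hs)) fun s hs => hasDerivAt_log_sub (h s hs)

theorem segIntegral_inv_sub' {a u v : ℂ} (h : ∀ s ∈ segment ℝ u v, a - s ∈ Complex.slitPlane) :
    segIntegral (fun s => (s - a)⁻¹) u v = Complex.log (a - v) - Complex.log (a - u) :=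
  segIntegral_eq_sub (G := fun s => Complex.log (a - s)) (ContinuousOn.inv₀ (by fun_prop)
    fun s hs h0 => Complex.slitPlane_ne_zero (h s hs) (by rw [← neg_sub, h0, neg_zero]))
    fun s hs => hasDerivAt_log_sub' (h s hs)

theorem log_neg_of_im_pos {z : ℂ} (h : 0 < z.im) :
    Complex.log (-z) = Complex.log z - Real.pi * Complex.I := by
  simp only [Complex.log, norm_neg, Complex.arg_neg_eq_arg_sub_pi_of_im_pos h]
  push_cast; ring

theorem tendsto_arg_add_mul_I {x : ℝ} (hx : 0 < x) :
    Tendsto (fun T : ℝ => Complex.arg (x + T * Complex.I)) atTop (𝓝 (Real.pi / 2)) := by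
  have h : Tendsto (fun T : ℝ => Real.arctan (T / x)) atTop (𝓝 (Real.pi / 2)) :=
    (tendsto_nhds_of_tendsto_nhdsWithin Real.tendsto_arctan_atTop).comp
      (tendsto_id.atTop_div_const hx)
  refine h.congr fun T => ?_
  have h0 : 0 < ((x : ℂ) + T * Complex.I).re := by simpa using hx
  rw [← Real.arctan_tan (x := Complex.arg (x + T * Complex.I)), Complex.tan_arg]
  · simp
  · exact (abs_lt.1 (Complex.abs_arg_lt_pi_div_two_iff.2 (Or.inl h0))).1
  · exact (abs_lt.1 (Complex.abs_arg_lt_pi_div_two_iff.2 (Or.inl h0))).2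

/-- The two arguments are complex conjugates, so the difference is `2i arg (x + iT)`, and the
argument tends to `π/2`. This is the source of the index `±1/2` of a vertical line. -/
theorem tendsto_log_sub_log {x : ℝ} (hx : 0 < x) :
    Tendsto (fun T : ℝ => Complex.log (x + T * Complex.I) - Complex.log (x - T * Complex.I)) atTop
      (𝓝 (Real.pi * Complex.I)) := by
  have h := ((Complex.continuous_ofReal.tendsto _).comp (tendsto_arg_add_mul_I hx)).const_mul
    (2 * Complex.I)
  have e : (2 * Complex.I * ((Real.pi / 2 : ℝ) : ℂ)) = Real.pi * Complex.I := by push_cast; ring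
  rw [e] at h
  refine h.congr fun T => ?_
  have hc : (x : ℂ) - T * Complex.I = (starRingEnd ℂ) (x + T * Complex.I) := by simp [sub_eq_add_neg]
  have h0 : 0 < ((x : ℂ) + T * Complex.I).re := by simpa using hx
  have hpi : Complex.arg (x + T * Complex.I) ≠ Real.pi := by
    have := abs_lt.1 (Complex.abs_arg_lt_pi_div_two_iff.2 (Or.inl h0))
    linarith [Real.pi_pos, this.2]
  rw [hc, Complex.log_conj _ hpi]
  simp only [Function.comp, Complex.log, map_add, Complex.conj_ofReal, map_mul, Complex.conj_I]
  ring

end Log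

/-! ### A separating contour: a vertical line with loops. -/

section LoopContour

/-- The vertices, other than the final one `c + i`, of a closed path from `c + i` that goes around
`b` clockwise along the rectangle with corners `b ± δ ± i`. -/
def clockwiseLoop (c : ℝ) (p : ℝ × ℝ) : List ℂ :=
  [c + Complex.I, p.1 + p.2 + Complex.I, p.1 + p.2 - Complex.I, p.1 - p.2 - Complex.I,
    p.1 - p.2 + Complex.I]

/-- The vertical line through `c`, with an excursion around `b` for each `(b, δ)` in the list. -/
def loopContour (c : ℝ) (l : List (ℝ × ℝ)) : MBContour :=
  ⟨c, 1, zero_le_one, l.flatMap (clockwiseLoop c)⟩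

theorem exists_flatMap_clockwiseLoop (c : ℝ) (l : List (ℝ × ℝ)) :
    ∃ v, l.flatMap (clockwiseLoop c) ++ [(c : ℂ) + Complex.I] = (c + Complex.I) :: v := by
  cases l with
  | nil => exact ⟨[], rfl⟩
  | cons p l => exact ⟨_, by rw [List.flatMap_cons, clockwiseLoop]; rfl⟩

theorem polyIntegral_flatMap_clockwiseLoop (c : ℝ) (F : ℂ → ℂ) (l : List (ℝ × ℝ)) :
    polyIntegral F (l.flatMap (clockwiseLoop c) ++ [(c : ℂ) + Complex.I]) =
      (l.map fun p => polyIntegral F (clockwiseLoop c p ++ [(c : ℂ) + Complex.I])).sum := by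
  induction l with
  | nil => simp [polyIntegral]
  | cons p l ih =>
    obtain ⟨v, hv⟩ := exists_flatMap_clockwiseLoop c l
    rw [List.flatMap_cons, List.append_assoc, List.map_cons, List.sum_cons, ← ih, hv,
      polyIntegral_append]

theorem polyCarrier_flatMap_clockwiseLoop (c : ℝ) (l : List (ℝ × ℝ)) {s : ℂ}
    (hs : s ∈ polyCarrier (l.flatMap (clockwiseLoop c) ++ [(c : ℂ) + Complex.I])) :
    ∃ p ∈ l, s ∈ polyCarrier (clockwiseLoop c p ++ [(c : ℂ) + Complex.I]) := by
  induction l with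
  | nil => simp [polyCarrier] at hs
  | cons p l ih =>
    obtain ⟨v, hv⟩ := exists_flatMap_clockwiseLoop c l
    rw [List.flatMap_cons, List.append_assoc, hv, polyCarrier_append, ← hv] at hs
    rcases hs with hs | hs
    · exact ⟨p, by simp, hs⟩
    · obtain ⟨q, hq, h⟩ := ih hs
      exact ⟨q, by simp [hq], h⟩

theorem loopContour_nodes (c : ℝ) (l : List (ℝ × ℝ)) :
    (loopContour c l).nodes =
      ((c : ℂ) - Complex.I) :: (l.flatMap (clockwiseLoop c) ++ [(c : ℂ) + Complex.I]) := by
  simp [loopContour, MBContour.nodes]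

theorem truncIntegral_loopContour (c : ℝ) (l : List (ℝ × ℝ)) (F : ℂ → ℂ) (T : ℝ) :
    (loopContour c l).truncIntegral F T = (loopContour c []).truncIntegral F T +
      (l.map fun p => polyIntegral F (clockwiseLoop c p ++ [(c : ℂ) + Complex.I])).sum := by
  unfold MBContour.truncIntegral
  rw [loopContour_nodes, loopContour_nodes, ← polyIntegral_flatMap_clockwiseLoop]
  obtain ⟨v, hv⟩ := exists_flatMap_clockwiseLoop c l
  rw [hv]
  simp only [loopContour, polyIntegral, List.flatMap_nil, List.nil_append]
  ring

theorem mem_polyCarrier_clockwiseLoop {c : ℝ} {p : ℝ × ℝ} {s : ℂ}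
    (hs : s ∈ polyCarrier (clockwiseLoop c p ++ [(c : ℂ) + Complex.I])) :
    (s.im = 1 ∧ s.re ∈ uIcc c (p.1 + p.2)) ∨ s.re = p.1 + p.2 ∨
      (s.im = -1 ∧ s.re ∈ uIcc (p.1 + p.2) (p.1 - p.2)) ∨ s.re = p.1 - p.2 ∨
      (s.im = 1 ∧ s.re ∈ uIcc (p.1 - p.2) c) := by
  simp only [clockwiseLoop, List.cons_append, List.nil_append, polyCarrier, mem_union,
    mem_empty_iff_false, or_false] at hs
  rcases hs with hs | hs | hs | hs | hs
  all_goals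
    have := re_im_mem_of_mem_segment hs
    simp at this
    tauto

theorem mem_carrier_loopContour {c : ℝ} {l : List (ℝ × ℝ)} {s : ℂ}
    (hs : s ∈ (loopContour c l).carrier) :
    s.re = c ∨ ∃ p ∈ l, s ∈ polyCarrier (clockwiseLoop c p ++ [(c : ℂ) + Complex.I]) := by
  rcases hs with ⟨y, -, rfl⟩ | hs
  · simp [loopContour]
  · rw [loopContour_nodes] at hs
    obtain ⟨v, hv⟩ := exists_flatMap_clockwiseLoop c l
    rw [hv, polyCarrier, ← hv] at hs
    rcases hs with hs | hs
    · left
      simpa using (re_im_mem_of_mem_segment hs).1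
    · exact Or.inr (polyCarrier_flatMap_clockwiseLoop c l hs)

theorem re_le_of_mem_carrier_loopContour {c : ℝ} {l : List (ℝ × ℝ)}
    (hl : ∀ p ∈ l, 0 < p.2 ∧ p.1 + p.2 < c) {s : ℂ} (hs : s ∈ (loopContour c l).carrier) :
    s.re ≤ c := by
  rcases mem_carrier_loopContour hs with h | ⟨p, hp, h⟩
  · exact h.le
  · obtain ⟨h1, h2⟩ := hl p hp
    rcases mem_polyCarrier_clockwiseLoop h with h | h | h | h | h
    · have := h.2; rw [mem_uIcc] at this; rcases this with h | h <;> linarith [h.1, h.2]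
    · linarith
    · have := h.2; rw [mem_uIcc] at this; rcases this with h | h <;> linarith [h.1, h.2]
    · linarith
    · have := h.2; rw [mem_uIcc] at this; rcases this with h | h <;> linarith [h.1, h.2]

theorem not_mem_carrier_loopContour {c : ℝ} {l : List (ℝ × ℝ)} {a : ℝ} (hac : a ≠ c)
    (hl : ∀ p ∈ l, 0 < p.2 ∧ (a = p.1 ∨ p.2 < |a - p.1|)) :
    (a : ℂ) ∉ (loopContour c l).carrier := by
  intro hs
  rcases mem_carrier_loopContour hs with h | ⟨p, hp, h⟩
  · exact hac (by simpa using h)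
  · obtain ⟨h1, h2⟩ := hl p hp
    have hne : a ≠ p.1 + p.2 ∧ a ≠ p.1 - p.2 := by
      rcases h2 with rfl | h2
      · constructor <;> intro h <;> linarith
      · constructor <;> rintro rfl
        · rw [add_sub_cancel_left, abs_of_pos h1] at h2; exact lt_irrefl _ h2
        · rw [sub_sub_cancel_left, abs_neg, abs_of_pos h1] at h2; exact lt_irrefl _ h2
    have := mem_polyCarrier_clockwiseLoop h
    simp at this
    tauto

theorem mem_slitPlane_of_segment {u v w : ℂ} {a : ℝ}
    (h : w ∈ segment ℝ u v) (h' : (a < u.re ∧ a < v.re) ∨ (u.im = v.im ∧ u.im ≠ 0)) :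
    w - a ∈ Complex.slitPlane := by
  obtain ⟨h1, h2⟩ := re_im_mem_of_mem_segment h
  rw [Complex.mem_slitPlane_iff]
  rcases h' with ⟨h3, h4⟩ | ⟨h3, h4⟩
  · left
    have := h1.1
    simp only [Complex.sub_re, Complex.ofReal_re, sub_pos]
    exact (lt_min h3 h4).trans_le this
  · right
    rw [← h3, uIcc_self, mem_singleton_iff] at h2
    simpa [h2] using h4

theorem mem_slitPlane_of_segment' {u v w : ℂ} {a : ℝ}
    (h : w ∈ segment ℝ u v) (h' : (u.re < a ∧ v.re < a) ∨ (u.im = v.im ∧ u.im ≠ 0)) :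
    a - w ∈ Complex.slitPlane := by
  obtain ⟨h1, h2⟩ := re_im_mem_of_mem_segment h
  rw [Complex.mem_slitPlane_iff]
  rcases h' with ⟨h3, h4⟩ | ⟨h3, h4⟩
  · left
    have := h1.2
    simp only [Complex.sub_re, Complex.ofReal_re, sub_pos]
    exact this.trans_lt (max_lt h3 h4)
  · right
    rw [← h3, uIcc_self, mem_singleton_iff] at h2
    simpa [h2] using h4

/-- The branch `log (s - a)` is holomorphic along the whole loop: the vertical sides lie to the
right of `a`, and the horizontal parts avoid the real axis. The integral over the closed path
telescopes to zero. -/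
theorem polyIntegral_clockwiseLoop_of_lt {c a : ℝ} {p : ℝ × ℝ} (hp : 0 < p.2)
    (h : a < p.1 - p.2) :
    polyIntegral (fun s => (s - a)⁻¹) (clockwiseLoop c p ++ [(c : ℂ) + Complex.I]) = 0 := by
  simp only [clockwiseLoop, List.cons_append, List.nil_append, polyIntegral]
  rw [segIntegral_inv_sub fun s hs => mem_slitPlane_of_segment hs (Or.inr (by simp)),
    segIntegral_inv_sub fun s hs => mem_slitPlane_of_segment hs (Or.inl
      ⟨by simp; linarith, by simp; linarith⟩),
    segIntegral_inv_sub fun s hs => mem_slitPlane_of_segment hs (Or.inr (by simp)),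
    segIntegral_inv_sub fun s hs => mem_slitPlane_of_segment hs (Or.inl
      ⟨by simp; linarith, by simp; linarith⟩),
    segIntegral_inv_sub fun s hs => mem_slitPlane_of_segment hs (Or.inr (by simp))]
  ring

/-- The mirror image, with the branch `log (a - s)`. -/
theorem polyIntegral_clockwiseLoop_of_gt {c a : ℝ} {p : ℝ × ℝ} (hp : 0 < p.2)
    (h : p.1 + p.2 < a) :
    polyIntegral (fun s => (s - a)⁻¹) (clockwiseLoop c p ++ [(c : ℂ) + Complex.I]) = 0 := by
  simp only [clockwiseLoop, List.cons_append, List.nil_append, polyIntegral]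
  rw [segIntegral_inv_sub' fun s hs => mem_slitPlane_of_segment' hs (Or.inr (by simp)),
    segIntegral_inv_sub' fun s hs => mem_slitPlane_of_segment' hs (Or.inl
      ⟨by simp; linarith, by simp; linarith⟩),
    segIntegral_inv_sub' fun s hs => mem_slitPlane_of_segment' hs (Or.inr (by simp)),
    segIntegral_inv_sub' fun s hs => mem_slitPlane_of_segment' hs (Or.inl
      ⟨by simp; linarith, by simp; linarith⟩),
    segIntegral_inv_sub' fun s hs => mem_slitPlane_of_segment' hs (Or.inr (by simp))]
  ring

/-- Only the left side of the rectangle crosses the cut of `log (s - p.1)`. The other branch is used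
there, and each of the two changes of branch contributes `-πi`. -/
theorem polyIntegral_clockwiseLoop_self (c : ℝ) {p : ℝ × ℝ} (hp : 0 < p.2) :
    polyIntegral (fun s => (s - p.1)⁻¹) (clockwiseLoop c p ++ [(c : ℂ) + Complex.I]) =
      -(2 * Real.pi * Complex.I) := by
  simp only [clockwiseLoop, List.cons_append, List.nil_append, polyIntegral]
  rw [segIntegral_inv_sub fun s hs => mem_slitPlane_of_segment hs (Or.inr (by simp)),
    segIntegral_inv_sub fun s hs => mem_slitPlane_of_segment hs (Or.inl
      ⟨by simp; linarith, by simp; linarith⟩),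
    segIntegral_inv_sub fun s hs => mem_slitPlane_of_segment hs (Or.inr (by simp)),
    segIntegral_inv_sub' fun s hs => mem_slitPlane_of_segment' hs (Or.inl
      ⟨by simp; linarith, by simp; linarith⟩),
    segIntegral_inv_sub fun s hs => mem_slitPlane_of_segment hs (Or.inr (by simp))]
  have e1 : (p.1 : ℂ) - p.2 - Complex.I - p.1 = -(p.2 + Complex.I) := by ring
  have e2 : (p.1 : ℂ) - (p.1 - p.2 + Complex.I) = -(-p.2 + Complex.I) := by ring
  have e3 : (p.1 : ℂ) - (p.1 - p.2 - Complex.I) = p.2 + Complex.I := by ring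
  have e4 : (p.1 : ℂ) - p.2 + Complex.I - p.1 = -p.2 + Complex.I := by ring
  rw [e1, e2, e3, e4, log_neg_of_im_pos (by simp), log_neg_of_im_pos (by simp)]
  ring

theorem polyIntegral_clockwiseLoop {c a : ℝ} {p : ℝ × ℝ} (hp : 0 < p.2)
    (h : a = p.1 ∨ p.2 < |a - p.1|) :
    polyIntegral (fun s => (s - a)⁻¹) (clockwiseLoop c p ++ [(c : ℂ) + Complex.I]) =
      -(2 * Real.pi * Complex.I) * if p.1 = a then 1 else 0 := by
  rcases h with rfl | h
  · simpa using polyIntegral_clockwiseLoop_self c hp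
  · have hne : p.1 ≠ a := by
      rintro rfl
      simp at h
      linarith
    rw [if_neg hne, mul_zero]
    rcases lt_abs.1 h with h | h
    · exact polyIntegral_clockwiseLoop_of_gt hp (by linarith)
    · exact polyIntegral_clockwiseLoop_of_lt hp (by linarith)

theorem tendsto_truncIntegral_vertical {c a : ℝ} (hac : a ≠ c) :
    Tendsto (fun T => (loopContour c []).truncIntegral (fun s => (s - a)⁻¹) T) atTop
      (𝓝 ((if a < c then 1 else -1) * (Real.pi * Complex.I))) := by
  have hcar : ∀ s ∈ (loopContour c []).carrier, s.re = c := fun s hs => by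
    simpa using mem_carrier_loopContour hs
  have hcont : ContinuousOn (fun s : ℂ => (s - a)⁻¹) (loopContour c []).carrier :=
    ContinuousOn.inv₀ (by fun_prop) fun s hs h0 => hac (by
      rw [← hcar s hs, sub_eq_zero.1 h0, Complex.ofReal_re])
  rcases lt_or_gt_of_ne hac with h | h
  · rw [if_pos h, one_mul]
    refine (tendsto_log_sub_log (sub_pos.2 h)).congr' ?_
    filter_upwards [eventually_ge_atTop 1] with T hT
    rw [MBContour.truncIntegral_eq_sub (G := fun s => Complex.log (s - a)) hcont _ hT]
    · simp only [loopContour, Complex.ofReal_sub]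
      congr 2 <;> ring
    · exact fun s hs => hasDerivAt_log_sub (Or.inl (by simpa [hcar s hs] using h))
  · rw [if_neg h.not_gt, neg_one_mul]
    refine ((tendsto_log_sub_log (sub_pos.2 h)).neg).congr' ?_
    filter_upwards [eventually_ge_atTop 1] with T hT
    rw [MBContour.truncIntegral_eq_sub (G := fun s => Complex.log (a - s)) hcont _ hT]
    · simp only [loopContour, Complex.ofReal_sub, neg_sub]
      congr 2 <;> ring
    · exact fun s hs => hasDerivAt_log_sub' (Or.inl (by simpa [hcar s hs] using h))

/-- The vertical line contributes `±1/2`, and each clockwise loop around `a` subtracts one; loops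
around other points contribute nothing. -/
theorem hasIndex_loopContour {c a : ℝ} {l : List (ℝ × ℝ)} (hac : a ≠ c)
    (hl : ∀ p ∈ l, 0 < p.2 ∧ (a = p.1 ∨ p.2 < |a - p.1|)) :
    (loopContour c l).HasIndex a
      ((if a < c then 1 / 2 else -1 / 2) - ((l.map Prod.fst).count a : ℂ)) := by
  refine ⟨not_mem_carrier_loopContour hac hl, ?_⟩
  have hloops : (l.map fun p => polyIntegral (fun s => (s - (a : ℂ))⁻¹)
      (clockwiseLoop c p ++ [(c : ℂ) + Complex.I])).sum =
      -(2 * Real.pi * Complex.I) * ((l.map Prod.fst).count a : ℂ) := by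
    induction l with
    | nil => simp
    | cons p l ih =>
      rw [List.map_cons, List.sum_cons, ih fun q hq => hl q (by simp [hq]),
        polyIntegral_clockwiseLoop (hl p (by simp)).1 (hl p (by simp)).2, List.map_cons,
        List.count_cons]
      push_cast
      simp only [beq_iff_eq]
      ring
  have hsplit (T : ℝ) := truncIntegral_loopContour c l (fun s => (s - (a : ℂ))⁻¹) T
  simp only [hsplit, hloops]
  have := ((tendsto_truncIntegral_vertical hac).add_const
    (-(2 * Real.pi * Complex.I) * ((l.map Prod.fst).count a : ℂ))).const_mul
      (2 * Real.pi * Complex.I)⁻¹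
  convert this using 2
  have := Complex.two_pi_I_ne_zero
  split_ifs <;> (field_simp; ring)

/-- If the sets `L` and `P` of real points are disjoint and locally finite, and `P` is bounded
below, then each `c ∉ P` on the right of `L` is the right end of a contour that separates
`L` and `P`. -/
theorem exists_separating_contour {L P : Set ℝ} {c : ℝ} (hL : ∀ a ∈ L, a < c)
    (hP : c ∉ P) (hLP : Disjoint L P) (hPfin : (P ∩ Iio c).Finite)
    (hLfin : ∀ M : ℝ, (L ∩ Ici M).Finite) :
    ∃ C : MBContour, (∀ s ∈ C.carrier, s.re ≤ c) ∧
      C.Separates ((fun a : ℝ => (a : ℂ)) '' L) ((fun a : ℝ => (a : ℂ)) '' P) := by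
  classical
  have hδ : ∀ b : ℝ, b < c → ∃ δ : ℝ, 0 < δ ∧ b + δ < c ∧
      ∀ a ∈ L ∪ P, a = b ∨ δ < |a - b| := by
    intro b hb
    set S : Set ℝ := ((L ∩ Ici (b - 1)) ∪ (P ∩ Iio c)) \ {b} with hS
    -- Since `δ` is kept below `1` and below `c - b`, only left poles beyond `b - 1` and right poles
    -- before `c` can come within `δ` of `b`.
    have hSf : S.Finite := ((hLfin _).union hPfin).sdiff
    have hbS : b ∈ Sᶜ := by simp [hS]
    obtain ⟨ε, hε, hball⟩ := Metric.isOpen_iff.1 hSf.isClosed.isOpen_compl b hbS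
    have hm : 0 < min (min ε 1) (c - b) := lt_min (lt_min hε one_pos) (sub_pos.2 hb)
    refine ⟨min (min ε 1) (c - b) / 2, by positivity, ?_, ?_⟩
    · linarith [min_le_right (min ε 1) (c - b), half_lt_self hm]
    · intro a ha
      by_contra! hcon
      obtain ⟨hab, hd⟩ := hcon
      have hlt : |a - b| < min (min ε 1) (c - b) := hd.trans_lt (half_lt_self hm)
      rw [lt_min_iff, lt_min_iff] at hlt
      refine hball (Metric.mem_ball.2 (by rw [Real.dist_eq]; exact hlt.1.1)) ?_
      refine ⟨?_, hab⟩
      have := abs_lt.1 hlt.1.2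
      rcases ha with ha | ha
      · exact Or.inl ⟨ha, by simp only [mem_Ici]; linarith [this.1]⟩
      · exact Or.inr ⟨ha, by simp only [mem_Iio]; linarith [(abs_lt.1 hlt.2).2]⟩
  choose! δ hδ0 hδc hδ' using hδ
  set l : List (ℝ × ℝ) := hPfin.toFinset.toList.map fun b => (b, δ b) with hl
  have hmem : ∀ p ∈ l, p.1 < c ∧ p.2 = δ p.1 := by
    intro p hp
    simp only [hl, List.mem_map, Finset.mem_toList, Finite.mem_toFinset] at hp
    obtain ⟨b, hb, rfl⟩ := hp
    exact ⟨hb.2, rfl⟩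
  have hfst : l.map Prod.fst = hPfin.toFinset.toList := by
    simp [hl, Function.comp_def]
  have hidx : ∀ a ∈ L ∪ P, (loopContour c l).HasIndex a
      ((if a < c then 1 / 2 else -1 / 2) - (if a ∈ P ∧ a < c then 1 else 0)) := by
    intro a ha
    have hac : a ≠ c := by
      rcases ha with ha | ha
      · exact (hL a ha).ne
      · rintro rfl; exact hP ha
    have h := hasIndex_loopContour (l := l) hac fun p hp => by
      obtain ⟨h1, h2⟩ := hmem p hp
      rw [h2]
      exact ⟨hδ0 _ h1, hδ' _ h1 a ha⟩
    rw [hfst, List.Nodup.count (Finset.nodup_toList _)] at h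
    simpa using h
  refine ⟨loopContour c l, fun s hs => re_le_of_mem_carrier_loopContour (fun p hp => ?_) hs,
    ?_, ?_⟩
  · obtain ⟨h1, h2⟩ := hmem p hp
    rw [h2]
    exact ⟨hδ0 _ h1, hδc _ h1⟩
  · rintro _ ⟨a, ha, rfl⟩
    have h := hidx a (Or.inl ha)
    rwa [if_pos (hL a ha), if_neg (fun h => hLP.le_bot ⟨ha, h.1⟩), sub_zero] at h
  · rintro _ ⟨a, ha, rfl⟩
    have h := hidx a (Or.inr ha)
    by_cases hac : a < c
    -- A looped right pole has index `1/2 - 1 = -1/2`.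
    · rw [if_pos hac, if_pos ⟨ha, hac⟩] at h
      convert h using 1
      norm_num
    · rwa [if_neg hac, if_neg (fun h => hac h.2), sub_zero] at h

end LoopContour

/-! ### Exponential decay in vertical strips. -/

section Decay

/-- In vertical strips, `f s = O(exp (-θ |Im s|))` for each `θ < τ`. -/
def VerticalDecay (f : ℂ → ℂ) (τ : ℝ) : Prop :=
  ∀ θ < τ, ∀ M : ℝ, f =O[stripFilter M] fun s => Real.exp (-θ * |s.im|)

namespace VerticalDecay

variable {f g : ℂ → ℂ} {τ σ : ℝ}

theorem one : VerticalDecay (fun _ => 1) 0 := by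
  intro θ hθ M
  refine Asymptotics.IsBigO.of_bound 1 (Eventually.of_forall fun s => ?_)
  have : 0 ≤ -θ * |s.im| := mul_nonneg (by linarith) (abs_nonneg _)
  simpa using this

theorem mul (hf : VerticalDecay f τ) (hg : VerticalDecay g σ) :
    VerticalDecay (fun s => f s * g s) (τ + σ) := by
  intro θ hθ M
  -- The slack `τ + σ - θ` is shared equally between the two factors.
  refine ((hf (τ - (τ + σ - θ) / 2) (by linarith) M).mul
    (hg (σ - (τ + σ - θ) / 2) (by linarith) M)).congr_right fun s => ?_
  rw [← Real.exp_add]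
  congr 1
  ring

theorem prod {ι : Type*} (S : Finset ι) {f : ι → ℂ → ℂ} {τ : ι → ℝ}
    (h : ∀ i ∈ S, VerticalDecay (f i) (τ i)) :
    VerticalDecay (fun s => ∏ i ∈ S, f i s) (∑ i ∈ S, τ i) := by
  induction S using Finset.cons_induction with
  | empty => simpa using one
  | cons a S ha ih =>
    simp only [Finset.prod_cons, Finset.sum_cons]
    exact (h a (by simp)).mul (ih fun i hi => h i (by simp [hi]))

theorem congr (hf : VerticalDecay f τ) (h : ∀ s : ℂ, s.im ≠ 0 → f s = g s) :
    VerticalDecay g τ := by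
  intro θ hθ M
  refine (hf θ hθ M).congr' ?_ EventuallyEq.rfl
  refine eventually_stripFilter.2 ⟨1, fun s _ hs => h s ?_⟩
  intro h0
  rw [h0, abs_zero] at hs
  linarith

theorem comp_affine (hf : VerticalDecay f τ) (b : ℝ) {B : ℝ} (hB : B ≠ 0) :
    VerticalDecay (fun s => f (b + B * s)) (|B| * τ) := by
  intro θ hθ M
  have hB' : 0 < |B| := abs_pos.2 hB
  have ht : Tendsto (fun s : ℂ => (b + B * s : ℂ)) (stripFilter M)
      (stripFilter (|b| + |B| * M)) := by
    intro U hU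
    obtain ⟨Y, hY⟩ := eventually_stripFilter.1 hU
    refine eventually_stripFilter.2 ⟨Y / |B|, fun s hs hs' => hY _ ?_ ?_⟩
    · simp only [Complex.add_re, Complex.ofReal_re, Complex.re_ofReal_mul]
      refine (abs_add_le _ _).trans ?_
      rw [abs_mul]
      gcongr
    · simp only [Complex.add_im, Complex.ofReal_im, Complex.im_ofReal_mul, zero_add]
      rw [abs_mul, mul_comm]
      exact (div_le_iff₀ hB').1 hs'
  have h := (hf (θ / |B|) ((div_lt_iff₀ hB').2 (by rwa [mul_comm])) _).comp_tendsto ht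
  refine h.congr_right fun s => ?_
  simp only [Function.comp, Complex.add_im, Complex.ofReal_im, Complex.im_ofReal_mul, zero_add,
    abs_mul]
  congr 1
  field_simp

theorem tendsto_zero (hf : VerticalDecay f τ) (hτ : 0 < τ) (M : ℝ) :
    Tendsto f (stripFilter M) (𝓝 0) := by
  refine (hf (τ / 2) (half_lt_self hτ) M).trans_tendsto ?_
  have h1 : Tendsto (fun s : ℂ => |s.im|) (stripFilter M) atTop :=
    tendsto_comap.mono_left inf_le_left
  refine Real.tendsto_exp_atBot.comp ?_
  exact h1.const_mul_atTop_of_neg (by linarith)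

end VerticalDecay

/-- The reflection formula on the critical line, where `1 - z` is the conjugate of `z`. -/
theorem norm_Gamma_half_sq (y : ℝ) :
    ‖Complex.Gamma (1 / 2 + y * Complex.I)‖ ^ 2 = Real.pi / Real.cosh (Real.pi * y) := by
  have h := Complex.Gamma_mul_Gamma_one_sub (1 / 2 + y * Complex.I)
  have e1 : (1 : ℂ) - (1 / 2 + y * Complex.I) = (starRingEnd ℂ) (1 / 2 + y * Complex.I) := by
    apply Complex.ext <;> simp
    norm_num
  have e2 : (Real.pi : ℂ) * (1 / 2 + y * Complex.I) =
      ((Real.pi * y : ℝ) : ℂ) * Complex.I + Real.pi / 2 := by push_cast; ring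
  rw [e1, Complex.Gamma_conj, Complex.mul_conj, e2, Complex.sin_add_pi_div_two, Complex.cos_mul_I,
    ← Complex.ofReal_cosh, ← Complex.ofReal_div, Complex.ofReal_inj, Complex.normSq_eq_norm_sq] at h
  exact h

theorem norm_Gamma_half_le (y : ℝ) :
    ‖Complex.Gamma (1 / 2 + y * Complex.I)‖ ≤
      √(2 * Real.pi) * Real.exp (-(Real.pi / 2) * |y|) := by
  refine abs_le_of_sq_le_sq' ?_ (by positivity) |>.2
  rw [norm_Gamma_half_sq, mul_pow, Real.sq_sqrt (by positivity), ← Real.exp_nat_mul,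
    div_le_iff₀ (Real.cosh_pos _)]
  have hc : Real.exp (Real.pi * |y|) / 2 ≤ Real.cosh (Real.pi * y) := by
    rw [← Real.cosh_abs, abs_mul, abs_of_pos Real.pi_pos, Real.cosh_eq]
    gcongr
    linarith [Real.exp_pos (-(Real.pi * |y|))]
  have e : ((2 : ℕ) : ℝ) * (-(Real.pi / 2) * |y|) = -(Real.pi * |y|) := by push_cast; ring
  rw [e]
  calc Real.pi = 2 * Real.pi * Real.exp (-(Real.pi * |y|)) * (Real.exp (Real.pi * |y|) / 2) := by
        rw [Real.exp_neg]; field_simp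
    _ ≤ _ := by gcongr

theorem norm_Gamma_half_add_nat_le (N : ℕ) (y : ℝ) :
    ‖Complex.Gamma (N + 1 / 2 + y * Complex.I)‖ ≤
      (N + 1 + |y|) ^ N * ‖Complex.Gamma (1 / 2 + y * Complex.I)‖ := by
  induction N with
  | zero => simp
  | succ N ih =>
    set z : ℂ := N + 1 / 2 + y * Complex.I with hz
    have e : ((N + 1 : ℕ) : ℂ) + 1 / 2 + y * Complex.I = z + 1 := by rw [hz]; push_cast; ring
    have hz0 : z ≠ 0 := by
      intro h
      have := congrArg Complex.re h
      simp [hz] at this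
      have hN : (0 : ℝ) ≤ N := N.cast_nonneg
      linarith
    have hzn : ‖z‖ ≤ N + 1 + |y| := by
      refine (Complex.norm_le_abs_re_add_abs_im z).trans ?_
      have hN : (0 : ℝ) ≤ N := N.cast_nonneg
      have : |z.re| = N + 1 / 2 := by
        rw [hz]; simp; positivity
      rw [this]
      simp [hz]
      norm_num
    rw [e, Complex.Gamma_add_one z hz0, norm_mul]
    calc ‖z‖ * ‖Complex.Gamma z‖
        ≤ (N + 1 + |y|) * ((N + 1 + |y|) ^ N * ‖Complex.Gamma (1 / 2 + y * Complex.I)‖) := by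
          gcongr
      _ = (N + 1 + |y|) ^ (N + 1) * ‖Complex.Gamma (1 / 2 + y * Complex.I)‖ := by ring
      _ ≤ _ := by
          push_cast
          gcongr
          linarith

/-- `|Γ(x + iy)| / Γ(x)` increases with `x > 0`. -/
theorem norm_Gamma_mul_le {x x' : ℝ} (hx : 0 < x) (hxx' : x ≤ x') (y : ℝ) :
    ‖Complex.Gamma (x + y * Complex.I)‖ * Real.Gamma x' ≤
      ‖Complex.Gamma (x' + y * Complex.I)‖ * Real.Gamma x := by
  -- In Euler's limit formula the powers of `n` and the factorials cancel, leaving `∏ (x + j) / |x +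
  -- iy + j|`, in which every factor increases with `x`.
  have key (n : ℕ) (hn : n ≠ 0) :
      ‖Complex.GammaSeq (x + y * Complex.I) n‖ * ‖Complex.GammaSeq x' n‖ ≤
        ‖Complex.GammaSeq (x' + y * Complex.I) n‖ * ‖Complex.GammaSeq x n‖ := by
    have hx' := hx.trans_le hxx'
    have hn' : (0 : ℝ) < n := by exact_mod_cast Nat.pos_of_ne_zero hn
    have hpow (z : ℂ) : ‖(n : ℂ) ^ z‖ = (n : ℝ) ^ z.re := by
      rw [← Complex.ofReal_natCast, Complex.norm_cpow_eq_rpow_re_of_pos hn']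
    have hprod : (∏ j ∈ Finset.range (n + 1), ‖(x' : ℂ) + y * Complex.I + j‖) *
        (∏ j ∈ Finset.range (n + 1), ‖(x : ℂ) + j‖) ≤
        (∏ j ∈ Finset.range (n + 1), ‖(x : ℂ) + y * Complex.I + j‖) *
        (∏ j ∈ Finset.range (n + 1), ‖(x' : ℂ) + j‖) := by
      rw [← Finset.prod_mul_distrib, ← Finset.prod_mul_distrib]
      refine Finset.prod_le_prod (fun j _ => by positivity) fun j _ => ?_
      have hj : (0 : ℝ) ≤ j := j.cast_nonneg
      have hnorm (u : ℝ) (hu : 0 < u) : ‖(u : ℂ) + j‖ = u + j := by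
        rw [← Complex.ofReal_natCast, ← Complex.ofReal_add, Complex.norm_real, Real.norm_eq_abs,
          abs_of_pos (by positivity)]
      have hsq (u : ℝ) : ‖(u : ℂ) + y * Complex.I + j‖ ^ 2 = (u + j) ^ 2 + y ^ 2 := by
        rw [← Complex.normSq_eq_norm_sq, Complex.normSq_apply]
        simp; ring
      rw [hnorm x hx, hnorm x' (hx.trans_le hxx')]
      refine abs_le_of_sq_le_sq' ?_ (by positivity) |>.2
      rw [mul_pow, mul_pow, hsq, hsq]
      have : (x + j) ^ 2 ≤ (x' + j) ^ 2 := by gcongr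
      nlinarith [mul_le_mul_of_nonneg_left this (sq_nonneg y)]
    have hpos (u v : ℝ) (hu : 0 < u) :
        0 < ∏ j ∈ Finset.range (n + 1), ‖(u : ℂ) + v * Complex.I + j‖ := by
      refine Finset.prod_pos fun j _ => norm_pos_iff.2 fun h => ?_
      have := congrArg Complex.re h
      simp at this
      have hj : (0 : ℝ) ≤ j := j.cast_nonneg
      linarith
    have p1 := hpos x y hx
    have p2 := hpos x' y hx'
    have p3 := hpos x 0 hx
    have p4 := hpos x' 0 hx'
    simp only [Complex.ofReal_zero, zero_mul, add_zero] at p3 p4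
    simp only [Complex.GammaSeq, norm_mul, norm_div, hpow, norm_prod, Complex.add_re,
      Complex.ofReal_re, Complex.re_ofReal_mul, Complex.I_re, mul_zero, add_zero]
    rw [div_mul_div_comm, div_mul_div_comm, div_le_div_iff₀ (by positivity) (by positivity)]
    have hc : 0 ≤ (n : ℝ) ^ x * ‖(n.factorial : ℂ)‖ * ((n : ℝ) ^ x' * ‖(n.factorial : ℂ)‖) := by
      positivity
    have := mul_le_mul_of_nonneg_left hprod hc
    nlinarith [this]
  have hreal (u : ℝ) (hu : 0 < u) : ‖Complex.Gamma u‖ = Real.Gamma u := by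
    rw [Complex.Gamma_ofReal, Complex.norm_real, Real.norm_eq_abs,
      abs_of_pos (Real.Gamma_pos_of_pos hu)]
  rw [← hreal x hx, ← hreal x' (hx.trans_le hxx')]
  refine le_of_tendsto_of_tendsto
    ((Complex.GammaSeq_tendsto_Gamma _).norm.mul (Complex.GammaSeq_tendsto_Gamma _).norm)
    ((Complex.GammaSeq_tendsto_Gamma _).norm.mul (Complex.GammaSeq_tendsto_Gamma _).norm) ?_
  filter_upwards [eventually_ne_atTop 0] with n hn using key n hn

/-- Each step of the functional equation multiplies by a factor `z + j` of modulus at least `|Im z|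
≥ 1`. -/
theorem norm_Gamma_le_add_nat (N : ℕ) {z : ℂ} (hz : 1 ≤ |z.im|) :
    ‖Complex.Gamma z‖ ≤ ‖Complex.Gamma (z + N)‖ := by
  induction N with
  | zero => simp
  | succ N ih =>
    have h1 : 1 ≤ ‖z + N‖ := by
      refine hz.trans ?_
      simpa using Complex.abs_im_le_norm (z + N)
    have h0 : z + N ≠ 0 := norm_pos_iff.1 (one_pos.trans_le h1)
    have e : z + ((N + 1 : ℕ) : ℂ) = (z + N) + 1 := by push_cast; ring
    rw [e, Complex.Gamma_add_one _ h0, norm_mul]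
    exact ih.trans (le_mul_of_one_le_left (norm_nonneg _) h1)

/-- An elementary substitute for Stirling's formula. Shift `s` to the right until its real part is
in `[1, 2N]`, compare with the line `Re = 2N + 1/2` by monotonicity, and return to `Re = 1/2`, where
the modulus is explicit. The return costs a polynomial in `|Im s|`, absorbed by the gap between `θ`
and `π/2`. -/
theorem verticalDecay_Gamma : VerticalDecay Complex.Gamma (Real.pi / 2) := by
  intro θ hθ M
  obtain ⟨N, hN⟩ := exists_nat_ge (M + 1)
  obtain ⟨K, hK⟩ := (isCompact_Icc (a := (1 : ℝ)) (b := 2 * N)).exists_bound_of_continuousOn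
    (f := Real.Gamma) fun x hx => by
      refine (Real.differentiableAt_Gamma fun m h => ?_).continuousAt.continuousWithinAt
      have : (0 : ℝ) ≤ m := m.cast_nonneg
      linarith [hx.1]
  set Γ₀ := Real.Gamma (((2 * N : ℕ) : ℝ) + 1 / 2) with hΓ₀
  have hΓ₀pos : 0 < Γ₀ := Real.Gamma_pos_of_pos (by positivity)
  have hbig : (fun t : ℝ => (((2 * N : ℕ) : ℝ) + 1 + t) ^ (2 * N)) =O[atTop]
      fun t => Real.exp ((Real.pi / 2 - θ) * t) := by
    have h1 : (fun t : ℝ => ((2 * N : ℕ) : ℝ) + 1 + t) =O[atTop] fun t : ℝ => t := by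
      refine Asymptotics.IsBigO.add ?_ (Asymptotics.isBigO_refl _ _)
      exact (Asymptotics.isLittleO_const_id_atTop _).isBigO
    refine (h1.pow (2 * N)).trans ?_
    exact (isLittleO_pow_exp_pos_mul_atTop (2 * N) (by linarith)).isBigO
  have ht : Tendsto (fun s : ℂ => |s.im|) (stripFilter M) atTop :=
    tendsto_comap.mono_left inf_le_left
  have hbig' := (hbig.comp_tendsto ht).mul
    (Asymptotics.isBigO_refl (fun s : ℂ => Real.exp (-(Real.pi / 2) * |s.im|)) (stripFilter M))
  have hmain : Complex.Gamma =O[stripFilter M] fun s : ℂ =>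
      (((2 * N : ℕ) : ℝ) + 1 + |s.im|) ^ (2 * N) * Real.exp (-(Real.pi / 2) * |s.im|) := by
    refine Asymptotics.IsBigO.of_bound (K / Γ₀ * √(2 * Real.pi)) ?_
    refine eventually_stripFilter.2 ⟨1, fun s hs hs' => ?_⟩
    obtain ⟨hs1, hs2⟩ := abs_le.1 hs
    have hx : (1 : ℝ) ≤ s.re + N := by linarith
    have hx' : s.re + N ≤ 2 * N := by linarith
    have hmono := norm_Gamma_mul_le (x := s.re + N) (x' := ((2 * N : ℕ) : ℝ) + 1 / 2)
      (by linarith) (by push_cast; linarith) s.im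
    have e : ((s.re + N : ℝ) : ℂ) + s.im * Complex.I = s + N := by
      push_cast
      conv_rhs => rw [← Complex.re_add_im s]
      ring
    have e2 : ((((2 * N : ℕ) : ℝ) + 1 / 2 : ℝ) : ℂ) = ((2 * N : ℕ) : ℂ) + 1 / 2 := by
      push_cast; ring
    rw [e, e2, ← hΓ₀] at hmono
    have hKx : Real.Gamma (s.re + N) ≤ K := (le_abs_self _).trans (hK _ ⟨hx, hx'⟩)
    rw [Real.norm_eq_abs, abs_of_nonneg (by positivity)]
    have h2 := (norm_Gamma_half_add_nat_le (2 * N) s.im).trans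
      (mul_le_mul_of_nonneg_left (norm_Gamma_half_le s.im) (by positivity))
    calc ‖Complex.Gamma s‖ ≤ ‖Complex.Gamma (s + N)‖ := norm_Gamma_le_add_nat N hs'
      _ ≤ ‖Complex.Gamma (((2 * N : ℕ) : ℂ) + 1 / 2 + s.im * Complex.I)‖ *
          Real.Gamma (s.re + N) / Γ₀ := by rwa [le_div_iff₀ hΓ₀pos]
      _ ≤ ((((2 * N : ℕ) : ℝ) + 1 + |s.im|) ^ (2 * N) *
          (√(2 * Real.pi) * Real.exp (-(Real.pi / 2) * |s.im|))) * K / Γ₀ := by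
          have : 0 ≤ Real.Gamma (s.re + N) := Real.Gamma_nonneg_of_nonneg (by linarith)
          gcongr
      _ = _ := by ring
  refine (hmain.trans hbig').congr_right fun s => ?_
  simp only [Function.comp, ← Real.exp_add]
  congr 1
  ring

theorem verticalDecay_sin : VerticalDecay (fun s => Complex.sin (Real.pi * s)) (-Real.pi) := by
  intro θ hθ M
  refine Asymptotics.IsBigO.of_bound 1 (Eventually.of_forall fun s => ?_)
  rw [one_mul, Real.norm_eq_abs, Real.abs_exp]
  have h1 : ‖Complex.exp (-(Real.pi * s) * Complex.I)‖ ≤ Real.exp (Real.pi * |s.im|) := by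
    rw [Complex.norm_exp]
    simp
    gcongr
    exact le_abs_self _
  have h2 : ‖Complex.exp (Real.pi * s * Complex.I)‖ ≤ Real.exp (Real.pi * |s.im|) := by
    rw [Complex.norm_exp]
    simp
    rw [← mul_neg]
    gcongr
    exact neg_le_abs _
  have h3 : Real.exp (Real.pi * |s.im|) ≤ Real.exp (-θ * |s.im|) := by
    gcongr
    linarith
  rw [Complex.sin, norm_div, norm_mul, Complex.norm_I, mul_one, Complex.norm_ofNat]
  have := norm_sub_le (Complex.exp (-(Real.pi * s) * Complex.I))
    (Complex.exp (Real.pi * s * Complex.I))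
  linarith

/-- By reflection `1 / Γ(s) = Γ(1 - s) sin(πs) / π`, with rate `π/2 - π`. -/
theorem verticalDecay_inv_Gamma :
    VerticalDecay (fun s => (Complex.Gamma s)⁻¹) (-(Real.pi / 2)) := by
  have h1 := (verticalDecay_Gamma.comp_affine 1 (B := -1) (by norm_num)).mul verticalDecay_sin
  have h2 : VerticalDecay (fun _ => (Real.pi : ℂ)⁻¹) 0 := by
    intro θ hθ M
    refine (((VerticalDecay.one θ hθ M).const_mul_left (Real.pi : ℂ)⁻¹)).congr_left ?_
    simp
  have h := h1.mul h2
  rw [abs_neg, abs_one] at h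
  have e : 1 * (Real.pi / 2) + -Real.pi + 0 = -(Real.pi / 2) := by ring
  rw [e] at h
  refine h.congr fun s hs => ?_
  have hsin : Complex.sin (Real.pi * s) ≠ 0 := by
    intro h0
    obtain ⟨k, hk⟩ := Complex.sin_eq_zero_iff.1 h0
    rw [mul_comm (k : ℂ)] at hk
    have := mul_left_cancel₀ (by simp [Real.pi_ne_zero]) hk
    rw [this] at hs
    simp at hs
  have hr := Complex.Gamma_mul_Gamma_one_sub s
  have hpi : (Real.pi : ℂ) ≠ 0 := by simp [Real.pi_ne_zero]
  have hne : Complex.Gamma s ≠ 0 := by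
    intro h0
    rw [h0, zero_mul, eq_comm, div_eq_zero_iff] at hr
    tauto
  have e2 : ((1 : ℝ) : ℂ) + ((-1 : ℝ) : ℂ) * s = 1 - s := by push_cast; ring
  rw [e2]
  rw [eq_div_iff hsin] at hr
  refine eq_inv_of_mul_eq_one_left ?_
  linear_combination (Real.pi : ℂ)⁻¹ * hr + mul_inv_cancel₀ hpi

end Decay

/-! ### Convergence of the Mellin-Barnes integral. -/

section Convergence

theorem VerticalDecay.cpow_neg {t : ℝ} (ht : 0 < t) :
    VerticalDecay (fun s => (t : ℂ) ^ (-s)) 0 := by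
  intro θ hθ M
  have h1 : (fun s : ℂ => (t : ℂ) ^ (-s)) =O[stripFilter M] fun _ => (1 : ℂ) := by
    refine Asymptotics.IsBigO.of_bound (Real.exp (|Real.log t| * M)) ?_
    refine eventually_stripFilter.2 ⟨0, fun s hs _ => ?_⟩
    rw [Complex.norm_cpow_eq_rpow_re_of_pos ht, norm_one, mul_one, Real.rpow_def_of_pos ht]
    refine Real.exp_le_exp.2 ((le_abs_self _).trans ?_)
    rw [abs_mul, Complex.neg_re, abs_neg]
    gcongr
  exact h1.trans (VerticalDecay.one θ hθ M)

theorem MBContour.converges_of_verticalDecay {C : MBContour} {F : ℂ → ℂ} {τ : ℝ}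
    (hF : VerticalDecay F τ) (hτ : 0 < τ) (hc : ContinuousOn F C.carrier) : C.Converges F := by
  -- The sign `σ` treats the upper and the lower ray together.
  have key (σ : ℝ) (hσ : |σ| = 1) :
      IntegrableOn (fun y : ℝ => F (C.γ + (σ * y : ℝ) * Complex.I)) (Ici C.R) := by
    have hcont : ContinuousOn (fun y : ℝ => F (C.γ + (σ * y : ℝ) * Complex.I)) (Ici C.R) :=
      hc.comp (by fun_prop) fun y hy => ray_mem_carrier (by
        rw [abs_mul, hσ, one_mul]; exact le_trans hy (le_abs_self y))
    have ht : Tendsto (fun y : ℝ => (C.γ : ℂ) + (σ * y : ℝ) * Complex.I) atTop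
        (stripFilter |C.γ|) := by
      intro U hU
      obtain ⟨Y, hY⟩ := eventually_stripFilter.1 hU
      rw [mem_map]
      filter_upwards [eventually_ge_atTop Y] with y hy
      refine hY _ (by simp) ?_
      have : |σ * y| = |y| := by rw [abs_mul, hσ, one_mul]
      simpa [-abs_mul, this] using hy.trans (le_abs_self y)
    have ho := (hF (τ / 2) (half_lt_self hτ) |C.γ|).comp_tendsto ht
    have ho' : (fun y : ℝ => F (C.γ + (σ * y : ℝ) * Complex.I)) =O[atTop]
        fun y => Real.exp (-(τ / 2) * y) := by
      refine ho.congr' EventuallyEq.rfl ?_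
      filter_upwards [eventually_ge_atTop 0] with y hy
      have : |σ * y| = y := by rw [abs_mul, hσ, one_mul, abs_of_nonneg hy]
      simp [-abs_mul, this]
    exact (hcont.locallyIntegrableOn measurableSet_Ici).integrableOn_of_isBigO_atTop ho'
      ⟨Ioi 0, Ioi_mem_atTop 0, exp_neg_integrableOn_Ioi 0 (half_pos hτ)⟩
  constructor
  · have h := key (-1) (by simp)
    rw [← (Measure.measurePreserving_neg (volume : Measure ℝ)).integrableOn_comp_preimage
      (MeasurableEquiv.neg ℝ).measurableEmbedding]
    simpa [Function.comp_def] using h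
  · simpa using (key 1 (by simp)).mono_set Ioi_subset_Ici_self

end Convergence

/-! ### Poles, regularity and decay of `foxXi`. -/

section FoxXi

variable {m n p q : ℕ} {α A : Fin p → ℝ} {β B : Fin q → ℝ}

/-- `foxXi` as a product without division. -/
theorem foxXi_eq (m n : ℕ) {p q : ℕ} (α : Fin p → ℂ) (A : Fin p → ℝ) (β : Fin q → ℂ)
    (B : Fin q → ℝ) (s : ℂ) : foxXi m n α A β B s =
    ((∏ j ∈ Finset.univ.filter (fun j : Fin q => (j : ℕ) < m), Complex.Gamma (β j + B j * s)) *
    (∏ j ∈ Finset.univ.filter (fun j : Fin p => (j : ℕ) < n),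
      Complex.Gamma (1 - α j - A j * s))) *
    ((∏ j ∈ Finset.univ.filter (fun j : Fin q => m ≤ (j : ℕ)),
      (Complex.Gamma (1 - β j - B j * s))⁻¹) *
    (∏ j ∈ Finset.univ.filter (fun j : Fin p => n ≤ (j : ℕ)),
      (Complex.Gamma (α j + A j * s))⁻¹)) := by
  rw [foxXi, Finset.prod_inv_distrib, Finset.prod_inv_distrib, ← mul_inv, div_eq_mul_inv]

theorem differentiableAt_foxXi {α : Fin p → ℂ} {β : Fin q → ℂ} (hA : ∀ j, 0 < A j)
    (hB : ∀ j, 0 < B j) {s : ℂ} (hs : s ∉ foxLeftPoles m β B ∪ foxRightPoles n α A) :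
    DifferentiableAt ℂ (foxXi m n α A β B) s := by
  have e : foxXi m n α A β B = fun s => _ := funext fun s => foxXi_eq m n α A β B s
  rw [e]
  refine ((DifferentiableAt.fun_finsetProd fun j hj => ?_).mul
    (DifferentiableAt.fun_finsetProd fun j hj => ?_)).mul
    ((DifferentiableAt.fun_finsetProd fun j hj => ?_).mul
    (DifferentiableAt.fun_finsetProd fun j hj => ?_))
  · refine DifferentiableAt.comp s (Complex.differentiableAt_Gamma _ fun l hl => hs (Or.inl ?_))
      (by fun_prop)
    refine ⟨j, by simpa using hj, l, ?_⟩
    have : (B j : ℂ) ≠ 0 := by exact_mod_cast (hB j).ne'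
    field_simp
    linear_combination hl
  · refine DifferentiableAt.comp s (Complex.differentiableAt_Gamma _ fun l hl => hs (Or.inr ?_))
      (by fun_prop)
    refine ⟨j, by simpa using hj, l, ?_⟩
    have : (A j : ℂ) ≠ 0 := by exact_mod_cast (hA j).ne'
    field_simp
    linear_combination -hl
  · exact (Complex.differentiable_one_div_Gamma _).comp s
      (f := fun s => 1 - β j - B j * s) (by fun_prop)
  · exact (Complex.differentiable_one_div_Gamma _).comp s
      (f := fun s => α j + A j * s) (by fun_prop)

theorem meromorphicAt_foxXi (α : Fin p → ℂ) (β : Fin q → ℂ) (s : ℂ) :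
    MeromorphicAt (foxXi m n α A β B) s := by
  have hinv (f : ℂ → ℂ) (hf : Differentiable ℂ f) :
      MeromorphicAt (fun s => (Complex.Gamma (f s))⁻¹) s :=
    ((Complex.differentiable_one_div_Gamma.comp hf).analyticAt s).meromorphicAt
  have hG (f : ℂ → ℂ) (hf : Differentiable ℂ f) :
      MeromorphicAt (fun s => Complex.Gamma (f s)) s := by
    simpa [Pi.inv_def] using (hinv f hf).inv
  have e : foxXi m n α A β B = fun s => _ := funext fun s => foxXi_eq m n α A β B s
  rw [e]
  exact ((MeromorphicAt.fun_prod fun j _ => hG _ (by fun_prop)).mul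
    (MeromorphicAt.fun_prod fun j _ => hG _ (by fun_prop))).mul
    ((MeromorphicAt.fun_prod fun j _ => hinv _ (by fun_prop)).mul
    (MeromorphicAt.fun_prod fun j _ => hinv _ (by fun_prop)))

theorem VerticalDecay.Gamma_add (b : ℝ) {c : ℝ} (hc : 0 < c) :
    VerticalDecay (fun s => Complex.Gamma (b + c * s)) (c * (Real.pi / 2)) := by
  simpa only [abs_of_pos hc] using verticalDecay_Gamma.comp_affine b hc.ne'

theorem VerticalDecay.Gamma_sub (b : ℝ) {c : ℝ} (hc : 0 < c) :
    VerticalDecay (fun s => Complex.Gamma (b - c * s)) (c * (Real.pi / 2)) := by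
  simpa only [abs_neg, abs_of_pos hc, Complex.ofReal_neg, neg_mul, ← sub_eq_add_neg] using
    verticalDecay_Gamma.comp_affine b (neg_ne_zero.2 hc.ne')

theorem VerticalDecay.inv_Gamma_add (b : ℝ) {c : ℝ} (hc : 0 < c) :
    VerticalDecay (fun s => (Complex.Gamma (b + c * s))⁻¹) (c * -(Real.pi / 2)) := by
  simpa only [abs_of_pos hc] using verticalDecay_inv_Gamma.comp_affine b hc.ne'

theorem VerticalDecay.inv_Gamma_sub (b : ℝ) {c : ℝ} (hc : 0 < c) :
    VerticalDecay (fun s => (Complex.Gamma (b - c * s))⁻¹) (c * -(Real.pi / 2)) := by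
  simpa only [abs_neg, abs_of_pos hc, Complex.ofReal_neg, neg_mul, ← sub_eq_add_neg] using
    verticalDecay_inv_Gamma.comp_affine b (neg_ne_zero.2 hc.ne')

/-- Each numerator factor contributes its coefficient times `π/2`, each denominator factor the
negative of that; the total is the definition of `χ`. -/
theorem verticalDecay_foxXi (α : Fin p → ℝ) (β : Fin q → ℝ) (hA : ∀ j, 0 < A j)
    (hB : ∀ j, 0 < B j) :
    VerticalDecay (foxXi m n (fun j => (α j : ℂ)) A (fun j => (β j : ℂ)) B)
      (foxChi m n A B * (Real.pi / 2)) := by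
  have e : foxXi m n (fun j => (α j : ℂ)) A (fun j => (β j : ℂ)) B = fun s => _ :=
    funext fun s => foxXi_eq m n _ A _ B s
  rw [e]
  have h1 := VerticalDecay.prod (Finset.univ.filter (fun j : Fin q => (j : ℕ) < m))
    fun j _ => VerticalDecay.Gamma_add (β j) (hB j)
  have h2 := VerticalDecay.prod (Finset.univ.filter (fun j : Fin p => (j : ℕ) < n))
    fun j _ => VerticalDecay.Gamma_sub (1 - α j) (hA j)
  have h3 := VerticalDecay.prod (Finset.univ.filter (fun j : Fin q => m ≤ (j : ℕ)))
    fun j _ => VerticalDecay.inv_Gamma_sub (1 - β j) (hB j)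
  have h4 := VerticalDecay.prod (Finset.univ.filter (fun j : Fin p => n ≤ (j : ℕ)))
    fun j _ => VerticalDecay.inv_Gamma_add (α j) (hA j)
  have h := (h1.mul h2).mul (h3.mul h4)
  simp only [← Finset.sum_mul] at h
  push_cast at h
  convert h using 1
  rw [foxChi]
  ring

/-- The poles of `Γ(β_j + B_j s)`, `j ≤ m`, for real parameters. -/
def realLeftPoles (m : ℕ) {q : ℕ} (β B : Fin q → ℝ) : Set ℝ :=
  {x | ∃ j : Fin q, (j : ℕ) < m ∧ ∃ l : ℕ, x = -(β j + l) / B j}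

/-- The poles of `Γ(1 - α_j - A_j s)`, `j ≤ n`, for real parameters. -/
def realRightPoles (n : ℕ) {p : ℕ} (α A : Fin p → ℝ) : Set ℝ :=
  {x | ∃ j : Fin p, (j : ℕ) < n ∧ ∃ l : ℕ, x = (1 - α j + l) / A j}

theorem foxLeftPoles_ofReal (m : ℕ) (β B : Fin q → ℝ) :
    foxLeftPoles m (fun j => (β j : ℂ)) B = (fun a : ℝ => (a : ℂ)) '' realLeftPoles m β B := by
  ext s
  constructor
  · rintro ⟨j, hj, l, rfl⟩
    exact ⟨_, ⟨j, hj, l, rfl⟩, by push_cast; rfl⟩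
  · rintro ⟨_, ⟨j, hj, l, rfl⟩, rfl⟩
    exact ⟨j, hj, l, by push_cast; rfl⟩

theorem foxRightPoles_ofReal (n : ℕ) (α A : Fin p → ℝ) :
    foxRightPoles n (fun j => (α j : ℂ)) A = (fun a : ℝ => (a : ℂ)) '' realRightPoles n α A := by
  ext s
  constructor
  · rintro ⟨j, hj, l, rfl⟩
    exact ⟨_, ⟨j, hj, l, rfl⟩, by push_cast; rfl⟩
  · rintro ⟨_, ⟨j, hj, l, rfl⟩, rfl⟩
    exact ⟨j, hj, l, by push_cast; rfl⟩

theorem finite_realRightPoles_inter_Iic (n : ℕ) (α : Fin p → ℝ) (hA : ∀ j, 0 < A j) (M : ℝ) :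
    (realRightPoles n α A ∩ Iic M).Finite := by
  refine (finite_iUnion fun j : Fin p => ((finite_Iic ⌊A j * M + α j - 1⌋₊).image
    fun l : ℕ => (1 - α j + l) / A j)).subset ?_
  rintro _ ⟨⟨j, hj, l, rfl⟩, hl⟩
  refine mem_iUnion.2 ⟨j, l, Nat.le_floor ?_, rfl⟩
  rw [mem_Iic, div_le_iff₀ (hA j)] at hl
  linarith

theorem finite_realLeftPoles_inter_Ici (m : ℕ) (β : Fin q → ℝ) (hB : ∀ j, 0 < B j) (M : ℝ) :
    (realLeftPoles m β B ∩ Ici M).Finite := by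
  refine (finite_iUnion fun j : Fin q => ((finite_Iic ⌊-(M * B j) - β j⌋₊).image
    fun l : ℕ => -(β j + l) / B j)).subset ?_
  rintro _ ⟨⟨j, hj, l, rfl⟩, hl⟩
  refine mem_iUnion.2 ⟨j, l, Nat.le_floor ?_, rfl⟩
  rw [mem_Ici, le_div_iff₀ (hB j)] at hl
  linarith

theorem finite_foxPoles_inter (m n : ℕ) (α : Fin p → ℝ) (β : Fin q → ℝ) (hA : ∀ j, 0 < A j)
    (hB : ∀ j, 0 < B j) (M : ℝ) :
    ((foxLeftPoles m (fun j => (β j : ℂ)) B ∪ foxRightPoles n (fun j => (α j : ℂ)) A) ∩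
      {s | |s.re| ≤ M}).Finite := by
  rw [foxLeftPoles_ofReal, foxRightPoles_ofReal]
  refine (((finite_realLeftPoles_inter_Ici m β hB (-M)).image (fun a : ℝ => (a : ℂ))).union
    ((finite_realRightPoles_inter_Iic n α hA M).image (fun a : ℝ => (a : ℂ)))).subset ?_
  rintro _ ⟨⟨a, ha, rfl⟩ | ⟨a, ha, rfl⟩, hM⟩
  · exact Or.inl ⟨a, ⟨ha, (abs_le.1 (by simpa using hM)).1⟩, rfl⟩
  · exact Or.inr ⟨a, ⟨ha, (abs_le.1 (by simpa using hM)).2⟩, rfl⟩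

theorem disjoint_realPoles (hA : ∀ j, 0 < A j) (hB : ∀ j, 0 < B j)
    (h : FoxPolesDistinct m n (fun j => (α j : ℂ)) A (fun j => (β j : ℂ)) B) :
    Disjoint (realLeftPoles m β B) (realRightPoles n α A) := by
  rw [Set.disjoint_left]
  rintro _ ⟨j', hj', l, rfl⟩ ⟨j, hj, l', hl⟩
  refine h j hj j' hj' l l' ?_
  have h1 := (hA j).ne'
  have h2 := (hB j').ne'
  rw [div_eq_div_iff h2 h1] at hl
  have : A j * (l + β j') = B j' * (α j - l' - 1) := by linarith
  beta_reduce
  exact_mod_cast this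

theorem IsFoxContour.differentiableAt {α : Fin p → ℂ} {β : Fin q → ℂ} {C : MBContour}
    (hC : IsFoxContour m n α A β B C) (hA : ∀ j, 0 < A j) (hB : ∀ j, 0 < B j) {s : ℂ}
    (hs : s ∈ C.carrier) : DifferentiableAt ℂ (foxXi m n α A β B) s := by
  refine differentiableAt_foxXi hA hB ?_
  rintro (h | h)
  · exact (hC.1 s h).1 hs
  · exact (hC.2 s h).1 hs

theorem differentiable_cpow_neg {t : ℝ} (ht : 0 < t) :
    Differentiable ℂ fun s : ℂ => (t : ℂ) ^ (-s) := fun s =>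
  (differentiableAt_id.neg).const_cpow (Or.inl (by exact_mod_cast ht.ne'))

theorem IsFoxContour.converges {C : MBContour}
    (hC : IsFoxContour m n (fun j => (α j : ℂ)) A (fun j => (β j : ℂ)) B C) (hA : ∀ j, 0 < A j)
    (hB : ∀ j, 0 < B j) (hχ : 0 < foxChi m n A B) {t : ℝ} (ht : 0 < t) :
    C.Converges fun s =>
      foxXi m n (fun j => (α j : ℂ)) A (fun j => (β j : ℂ)) B s * (t : ℂ) ^ (-s) := by
  refine MBContour.converges_of_verticalDecay
    ((verticalDecay_foxXi α β hA hB).mul (VerticalDecay.cpow_neg ht))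
    (by rw [add_zero]; positivity) fun s hs => ?_
  exact ((hC.differentiableAt hA hB hs).mul
    (differentiable_cpow_neg ht s)).continuousAt.continuousWithinAt

/-- The Fox `H`-function may be computed along any admissible contour. -/
theorem foxH_eq {C : MBContour}
    (hC : IsFoxContour m n (fun j => (α j : ℂ)) A (fun j => (β j : ℂ)) B C) (hA : ∀ j, 0 < A j)
    (hB : ∀ j, 0 < B j) (hχ : 0 < foxChi m n A B) {t : ℝ} (ht : 0 < t) :
    foxH m n (fun j => (α j : ℂ)) A (fun j => (β j : ℂ)) B (t : ℂ) =
      (2 * Real.pi * Complex.I)⁻¹ * C.integral fun s =>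
        foxXi m n (fun j => (α j : ℂ)) A (fun j => (β j : ℂ)) B s * (t : ℂ) ^ (-s) := by
  have hex : ∃ C : MBContour,
      IsFoxContour m n (fun j => (α j : ℂ)) A (fun j => (β j : ℂ)) B C := ⟨C, hC⟩
  rw [foxH, dif_pos hex]
  congr 1
  have hC' := hex.choose_spec
  refine MBContour.integral_eq_integral
    (finite_foxPoles_inter m n α β hA hB)
    (fun s hs => (differentiableAt_foxXi hA hB hs).mul (differentiable_cpow_neg ht s))
    (fun a => (meromorphicAt_foxXi _ _ a).mul
      ((differentiable_cpow_neg ht).analyticAt a).meromorphicAt)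
    (fun M => ((verticalDecay_foxXi α β hA hB).mul (VerticalDecay.cpow_neg ht)).tendsto_zero
      (by rw [add_zero]; positivity) M)
    (hC'.converges hA hB hχ ht) (hC.converges hA hB hχ ht) ?_
  rintro a (ha | ha)
  · exact ⟨_, hC'.1 a ha, hC.1 a ha⟩
  · exact ⟨_, hC'.2 a ha, hC.2 a ha⟩

end FoxXi

/-! ### Inserting Gamma factors by Euler's integral. -/

section GammaTransform

theorem integral_pos_of_pos {g : ℝ → ℂ} (hg : IntegrableOn g (Ioi 0))
    (hpos : ∀ x : ℝ, 0 < x → 0 < g x) : 0 < ∫ x in Ioi (0 : ℝ), g x := by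
  have hre : ∫ x in Ioi (0 : ℝ), g x = ((∫ x in Ioi (0 : ℝ), (g x).re : ℝ) : ℂ) := by
    rw [← integral_complex_ofReal]
    refine setIntegral_congr_fun measurableSet_Ioi fun x hx => ?_
    have := (Complex.pos_iff.1 (hpos x hx)).2
    exact Complex.ext rfl (by simp [← this])
  rw [hre, Complex.zero_lt_real]
  rw [setIntegral_pos_iff_support_of_nonneg_ae]
  · have : Ioi (0 : ℝ) ⊆ Function.support (fun x => (g x).re) ∩ Ioi 0 := fun x hx =>
      ⟨(Complex.pos_iff.1 (hpos x hx)).1.ne', hx⟩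
    refine lt_of_lt_of_le ?_ (measure_mono this)
    simp
  · filter_upwards [ae_restrict_mem measurableSet_Ioi] with x hx
    exact (Complex.pos_iff.1 (hpos x hx)).1.le
  · exact hg.re

/-- Gives a bound for `|u^{-s}|` that is uniform over a strip, as needed to dominate the double
integral. -/
theorem rpow_le_rpow_add_rpow {u a b σ : ℝ} (hu : 0 < u) (ha : a ≤ σ) (hb : σ ≤ b) :
    u ^ σ ≤ u ^ a + u ^ b := by
  rcases le_total u 1 with h | h
  · exact (Real.rpow_le_rpow_of_exponent_ge hu h ha).trans
      (le_add_of_nonneg_right (Real.rpow_nonneg hu.le _))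
  · exact (Real.rpow_le_rpow_of_exponent_le h hb).trans
      (le_add_of_nonneg_left (Real.rpow_nonneg hu.le _))

/-- The density of the Gamma distribution, up to its constant. -/
noncomputable def gammaWeight (ω x : ℝ) : ℝ := Real.exp (-x) * x ^ (ω - 1)

theorem gammaWeight_pos (ω : ℝ) {x : ℝ} (hx : 0 < x) : 0 < gammaWeight ω x := by
  unfold gammaWeight; positivity

/-- Up to a constant this is the integrand of `Γ(ω - λ c)`; the hypothesis makes that argument
positive. -/
theorem integrableOn_gammaWeight_mul {ω lam t c : ℝ} (ht : 0 < t) (hc : lam * c < ω) :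
    IntegrableOn (fun x => gammaWeight ω x * (t * x ^ lam) ^ (-c)) (Ioi 0) := by
  have h := (Real.GammaIntegral_convergent (sub_pos.2 hc)).const_mul (t ^ (-c))
  refine h.congr ?_
  filter_upwards [ae_restrict_mem measurableSet_Ioi] with x hx
  have hx' : (0 : ℝ) < x := hx
  rw [gammaWeight, Real.mul_rpow ht.le (by positivity), ← Real.rpow_mul hx'.le,
    show ω - lam * c - 1 = (ω - 1) + lam * -c by ring, Real.rpow_add hx']
  ring

theorem gammaWeight_mul_cpow {ω lam t x : ℝ} (ht : 0 < t) (hx : 0 < x) (s : ℂ) :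
    (gammaWeight ω x : ℂ) * ((t * x ^ lam : ℝ) : ℂ) ^ (-s) =
      (t : ℂ) ^ (-s) * (Real.exp (-x) * (x : ℂ) ^ (ω - lam * s - 1)) := by
  have hx0 : (x : ℂ) ≠ 0 := by exact_mod_cast hx.ne'
  have hpow : ((x ^ lam : ℝ) : ℂ) ^ (-s) = (x : ℂ) ^ (lam * -s) := by
    have h0 : ((x ^ lam : ℝ) : ℂ) ≠ 0 := by exact_mod_cast (Real.rpow_pos_of_pos hx lam).ne'
    rw [Complex.cpow_def_of_ne_zero h0, Complex.cpow_def_of_ne_zero hx0, ← Complex.ofReal_log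
      (Real.rpow_nonneg hx.le _), ← Complex.ofReal_log hx.le, Real.log_rpow hx]
    push_cast
    congr 1
    ring
  rw [gammaWeight, Complex.ofReal_mul t, Complex.mul_cpow_ofReal_nonneg ht.le (by positivity), hpow,
    Complex.ofReal_mul, Complex.ofReal_cpow hx.le,
    show (ω : ℂ) - lam * s - 1 = ((ω - 1 : ℝ) : ℂ) + lam * -s by push_cast; ring,
    Complex.cpow_add _ _ hx0]
  ring

/-- The functional `I` commutes with the integral transform with kernel
`exp (-x) x ^ (ω - 1) (t x ^ λ) ^ (-s)`. -/
def GammaCompatible (F : ℂ → ℂ) (ω lam t : ℝ) (I : (ℂ → ℂ) → ℂ) : Prop :=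
  IntegrableOn (fun x : ℝ =>
    (gammaWeight ω x : ℂ) * I fun s => F s * ((t * x ^ lam : ℝ) : ℂ) ^ (-s)) (Ioi 0) ∧
  ∫ x in Ioi (0 : ℝ), (gammaWeight ω x : ℂ) * I (fun s => F s * ((t * x ^ lam : ℝ) : ℂ) ^ (-s)) =
    I fun s => F s * Complex.Gamma (ω - lam * s) * (t : ℂ) ^ (-s)

variable {F : ℂ → ℂ} {ω lam t c₁ c₂ : ℝ}

theorem GammaCompatible.add {I J : (ℂ → ℂ) → ℂ} (hI : GammaCompatible F ω lam t I)
    (hJ : GammaCompatible F ω lam t J) : GammaCompatible F ω lam t fun g => I g + J g := by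
  unfold GammaCompatible
  simp only [mul_add]
  exact ⟨hI.1.add hJ.1, by rw [integral_add hI.1 hJ.1, hI.2, hJ.2]⟩

theorem GammaCompatible.zero : GammaCompatible F ω lam t fun _ => 0 := by
  simp [GammaCompatible]

/-- Fubini, followed by Euler's integral in `x`, which is valid because `λ Re φ(y) ≤ λ c₂ < ω`. A
general measure `μ` covers segments and rays at once. -/
theorem GammaCompatible.path {μ : Measure ℝ} [SFinite μ] {φ : ℝ → ℂ} (hφ : Continuous φ) {d : ℂ}
    (hf : Integrable (fun y => F (φ y) * d) μ)
    (hre : ∀ᵐ y ∂μ, c₁ ≤ (φ y).re ∧ (φ y).re ≤ c₂) (hcc : c₁ ≤ c₂) (hlam : 0 < lam)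
    (hc : lam * c₂ < ω) (ht : 0 < t) :
    GammaCompatible F ω lam t fun g => ∫ y, g (φ y) * d ∂μ := by
  set ν : Measure ℝ := volume.restrict (Ioi 0) with hν
  set Φ : ℝ → ℝ → ℂ := fun x y =>
    (gammaWeight ω x : ℂ) * (F (φ y) * ((t * x ^ lam : ℝ) : ℂ) ^ (-φ y) * d) with hΦ
  have hint : Integrable (Function.uncurry Φ) (ν.prod μ) := by
    have hg := (integrableOn_gammaWeight_mul (c := c₂) ht hc).add
      (integrableOn_gammaWeight_mul (c := c₁) ht (lt_of_le_of_lt (by gcongr) hc))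
    refine Integrable.mono' (hg.mul_prod hf.norm) ?_ ?_
    · have h1 : AEStronglyMeasurable (fun z : ℝ × ℝ => F (φ z.2) * d) (ν.prod μ) :=
        hf.aestronglyMeasurable.comp_snd
      have h2 : Measurable fun z : ℝ × ℝ =>
          (gammaWeight ω z.1 : ℂ) * ((t * z.1 ^ lam : ℝ) : ℂ) ^ (-φ z.2) := by
        have := hφ.measurable
        unfold gammaWeight
        fun_prop
      refine (h2.aestronglyMeasurable.mul h1).congr (Eventually.of_forall fun z => ?_)
      simp only [hΦ, Function.uncurry, Pi.mul_apply]
      ring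
    · have hx : ∀ᵐ z ∂ν.prod μ, z.1 ∈ Ioi (0 : ℝ) :=
        Measure.quasiMeasurePreserving_fst.ae (ae_restrict_mem measurableSet_Ioi)
      have hy : ∀ᵐ z ∂ν.prod μ, c₁ ≤ (φ z.2).re ∧ (φ z.2).re ≤ c₂ :=
        Measure.quasiMeasurePreserving_snd.ae hre
      filter_upwards [hx, hy] with z hz hz'
      have hz0 : (0 : ℝ) < z.1 := hz
      have hu : 0 < t * z.1 ^ lam := by positivity
      simp only [hΦ, Function.uncurry, norm_mul, Complex.norm_real, Real.norm_eq_abs,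
        abs_of_pos (gammaWeight_pos ω hz0), Complex.norm_cpow_eq_rpow_re_of_pos hu, Complex.neg_re,
        Pi.add_apply, ← mul_add]
      have := rpow_le_rpow_add_rpow hu (neg_le_neg hz'.2) (neg_le_neg hz'.1)
      have hw := (gammaWeight_pos ω hz0).le
      calc _ = gammaWeight ω z.1 * (t * z.1 ^ lam) ^ (-(φ z.2).re) * (‖F (φ z.2)‖ * ‖d‖) := by ring
        _ ≤ _ := by gcongr
  have hΦ' (x : ℝ) : ∫ y, Φ x y ∂μ =
      (gammaWeight ω x : ℂ) * ∫ y, F (φ y) * ((t * x ^ lam : ℝ) : ℂ) ^ (-φ y) * d ∂μ :=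
    integral_const_mul _ _
  refine ⟨?_, ?_⟩
  · exact hint.integral_prod_left.congr (Eventually.of_forall hΦ')
  · simp only [← hΦ']
    rw [integral_integral_swap hint]
    refine integral_congr_ae ?_
    filter_upwards [hre] with y hy
    have hG : 0 < ((ω : ℂ) - lam * φ y).re := by
      simp only [Complex.sub_re, Complex.ofReal_re, Complex.re_ofReal_mul, sub_pos]
      exact lt_of_le_of_lt (mul_le_mul_of_nonneg_left hy.2 hlam.le) hc
    rw [Complex.Gamma_eq_integral hG, Complex.GammaIntegral, hν]
    have : ∀ x ∈ Ioi (0 : ℝ), Φ x y = F (φ y) * d * (t : ℂ) ^ (-φ y) *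
        (Real.exp (-x) * (x : ℂ) ^ (ω - lam * φ y - 1)) := by
      intro x hx
      rw [mul_assoc _ ((t : ℂ) ^ (-φ y)), ← gammaWeight_mul_cpow ht hx]
      simp only [hΦ]
      ring
    rw [setIntegral_congr_fun measurableSet_Ioi this, integral_const_mul]
    ring

theorem GammaCompatible.polyIntegral (hlam : 0 < lam) (hc : lam * c₂ < ω) (ht : 0 < t)
    (hcc : c₁ ≤ c₂) : ∀ l : List ℂ, ContinuousOn F (polyCarrier l) →
    (∀ s ∈ polyCarrier l, c₁ ≤ s.re ∧ s.re ≤ c₂) →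
    GammaCompatible F ω lam t fun g => polyIntegral g l
  | [], _, _ => by simpa only [_root_.polyIntegral] using GammaCompatible.zero
  | [_], _, _ => by simpa only [_root_.polyIntegral] using GammaCompatible.zero
  | a :: b :: l, hF, hre => by
    simp only [_root_.polyIntegral]
    refine GammaCompatible.add ?_ (GammaCompatible.polyIntegral hlam hc ht hcc (b :: l)
      (hF.mono (polyCarrier_tail_subset _ _ _))
      fun s hs => hre s (polyCarrier_tail_subset _ _ _ hs))
    simp only [segIntegral, intervalIntegral.integral_of_le zero_le_one]
    refine GammaCompatible.path (φ := fun x : ℝ => a + x * (b - a)) (by fun_prop) ?_ ?_ hcc hlam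
      hc ht
    · exact (intervalIntegrable_iff_integrableOn_Ioc_of_le zero_le_one).1
        (intervalIntegrable_segment (hF.mono (segment_subset_polyCarrier_cons _ _ _)))
    · filter_upwards [ae_restrict_mem measurableSet_Ioc] with x hx
      exact hre _ (segment_subset_polyCarrier_cons _ _ _
        (add_mul_sub_mem_segment (Ioc_subset_Icc_self hx)))

theorem GammaCompatible.integral {C : MBContour} (hlam : 0 < lam) (hc : lam * c₂ < ω) (ht : 0 < t)
    (hF : ContinuousOn F C.carrier) (hconv : C.Converges F) (hre : ∀ s ∈ C.carrier, s.re ≤ c₂) :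
    GammaCompatible F ω lam t C.integral := by
  obtain ⟨M, hM⟩ := C.exists_abs_re_lt
  have hre' : ∀ s ∈ C.carrier, -M ≤ s.re ∧ s.re ≤ c₂ := fun s hs =>
    ⟨(abs_le.1 (hM s hs).le).1, hre s hs⟩
  have hcc : -M ≤ c₂ := by
    have := hre' _ (C.ray_mem_carrier (le_abs_self C.R))
    exact this.1.trans this.2
  change GammaCompatible F ω lam t fun g => C.integral g
  unfold MBContour.integral
  refine GammaCompatible.add (GammaCompatible.add ?_ ?_) ?_
  · refine GammaCompatible.path (φ := fun y : ℝ => C.γ + y * Complex.I) (by fun_prop)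
      (hconv.1.mul_const _) ?_ hcc hlam hc ht
    filter_upwards [ae_restrict_mem measurableSet_Iic] with y hy
    exact hre' _ (MBContour.ray_mem_carrier ((le_neg.1 hy).trans (neg_le_abs y)))
  · exact GammaCompatible.polyIntegral hlam hc ht hcc _
      (hF.mono MBContour.polyCarrier_subset_carrier)
      fun s hs => hre' s (MBContour.polyCarrier_subset_carrier hs)
  · refine GammaCompatible.path (φ := fun y : ℝ => C.γ + y * Complex.I) (by fun_prop)
      (hconv.2.mul_const _) ?_ hcc hlam hc ht
    filter_upwards [ae_restrict_mem measurableSet_Ioi] with y hy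
    exact hre' _ (MBContour.ray_mem_carrier ((le_of_lt hy).trans (le_abs_self y)))

/-- Multiplying a Mellin transform by Gamma factors, with all their poles on the right of the
contour, preserves the positivity of the original function. -/
theorem integral_mul_prod_Gamma_pos {C : MBContour} {ι : Type*} (S : Finset ι) {ω lam : ι → ℝ}
    {τ : ℝ} (hF : VerticalDecay F τ) (hτ : 0 < τ) (hcont : ContinuousOn F C.carrier)
    (hre : ∀ s ∈ C.carrier, s.re ≤ c₂) (hlam : ∀ i, 0 < lam i) (hω : ∀ i, lam i * c₂ < ω i)
    (hpos : ∀ t : ℝ, 0 < t →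
      0 < (2 * Real.pi * Complex.I)⁻¹ * C.integral fun s => F s * (t : ℂ) ^ (-s)) :
    ∀ t : ℝ, 0 < t → 0 < (2 * Real.pi * Complex.I)⁻¹ * C.integral fun s =>
      (F s * ∏ i ∈ S, Complex.Gamma (ω i - lam i * s)) * (t : ℂ) ^ (-s) := by
  induction S using Finset.cons_induction with
  | empty => simpa using hpos
  | cons a S ha ih =>
    intro t ht
    have hdecay : VerticalDecay (fun s => F s * ∏ i ∈ S, Complex.Gamma (ω i - lam i * s))
        (τ + ∑ i ∈ S, lam i * (Real.pi / 2)) :=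
      hF.mul (VerticalDecay.prod S fun i _ => VerticalDecay.Gamma_sub (ω i) (hlam i))
    have hτ' : 0 < τ + ∑ i ∈ S, lam i * (Real.pi / 2) :=
      add_pos_of_pos_of_nonneg hτ
        (Finset.sum_nonneg fun i _ => mul_nonneg (hlam i).le (by positivity))
    have hcont' : ContinuousOn (fun s => F s * ∏ i ∈ S, Complex.Gamma (ω i - lam i * s))
        C.carrier := by
      refine hcont.mul (continuousOn_finsetProd _ fun i _ s hs => ?_)
      refine (DifferentiableAt.comp s (Complex.differentiableAt_Gamma _ fun l hl => ?_)
        (by fun_prop)).continuousAt.continuousWithinAt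
      have h1 := congrArg Complex.re hl
      simp at h1
      have h2 := mul_le_mul_of_nonneg_left (hre s hs) (hlam i).le
      have h3 : (0 : ℝ) ≤ l := l.cast_nonneg
      linarith [hω i]
    obtain ⟨h1, h2⟩ := GammaCompatible.integral (hlam a) (hω a) ht hcont'
      (MBContour.converges_of_verticalDecay hdecay hτ' hcont') hre
    have e : (fun s => (F s * ∏ i ∈ Finset.cons a S ha, Complex.Gamma (ω i - lam i * s)) *
        (t : ℂ) ^ (-s)) = fun s => (F s * ∏ i ∈ S, Complex.Gamma (ω i - lam i * s)) *
          Complex.Gamma (ω a - lam a * s) * (t : ℂ) ^ (-s) := by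
      ext s
      rw [Finset.prod_cons]
      ring
    -- The factor indexed by `a` becomes an integral over `x` of the expression without it,
    -- evaluated at `t * x ^ lam a`, where `ih` gives positivity.
    rw [e, ← h2, ← integral_const_mul]
    refine integral_pos_of_pos (h1.const_mul _) fun x hx => ?_
    rw [mul_left_comm]
    exact mul_pos (Complex.zero_lt_real.2 (gammaWeight_pos _ hx)) (ih _ (by positivity))

end GammaTransform

/-! ### Effect of prepending upper parameters. -/

section Append

variable {k m n p q : ℕ}

theorem append_ofReal (f : Fin k → ℝ) (g : Fin p → ℝ) :
    Fin.append (fun j => (f j : ℂ)) (fun j => (g j : ℂ)) = fun j => ((Fin.append f g j : ℝ) : ℂ) := by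
  ext j
  refine Fin.addCases (fun i => ?_) (fun i => ?_) j <;> simp

theorem prod_filter_append_lt {M : Type*} [CommMonoid M] (f : Fin (k + p) → M) :
    ∏ j ∈ Finset.univ.filter (fun j : Fin (k + p) => (j : ℕ) < n + k), f j =
      (∏ j : Fin k, f (Fin.castAdd p j)) *
        ∏ j ∈ Finset.univ.filter (fun j : Fin p => (j : ℕ) < n), f (Fin.natAdd k j) := by
  rw [Finset.prod_filter, Fin.prod_univ_add, Finset.prod_filter]
  congr 1
  · refine Finset.prod_congr rfl fun j _ => if_pos ?_
    simp only [Fin.val_castAdd]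
    omega
  · refine Finset.prod_congr rfl fun j _ => ?_
    simp only [Fin.val_natAdd]
    congr 1
    simp only [eq_iff_iff]
    omega

theorem prod_filter_append_ge {M : Type*} [CommMonoid M] (f : Fin (k + p) → M) :
    ∏ j ∈ Finset.univ.filter (fun j : Fin (k + p) => n + k ≤ (j : ℕ)), f j =
      ∏ j ∈ Finset.univ.filter (fun j : Fin p => n ≤ (j : ℕ)), f (Fin.natAdd k j) := by
  rw [Finset.prod_filter, Fin.prod_univ_add, Finset.prod_filter]
  rw [Finset.prod_eq_one, one_mul]
  · refine Finset.prod_congr rfl fun j _ => ?_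
    simp only [Fin.val_natAdd]
    congr 1
    simp only [eq_iff_iff]
    omega
  · refine fun j _ => if_neg ?_
    simp only [Fin.val_castAdd]
    omega

theorem foxXi_append (α₀ : Fin k → ℂ) (A₀ : Fin k → ℝ) (α : Fin p → ℂ) (A : Fin p → ℝ)
    (β : Fin q → ℂ) (B : Fin q → ℝ) (s : ℂ) :
    foxXi m (n + k) (Fin.append α₀ α) (Fin.append A₀ A) β B s =
      foxXi m n α A β B s * ∏ j, Complex.Gamma (1 - α₀ j - A₀ j * s) := by
  rw [foxXi_eq, foxXi_eq, prod_filter_append_lt, prod_filter_append_ge]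
  simp only [Fin.append_left, Fin.append_right]
  ring

theorem foxChi_append (A₀ : Fin k → ℝ) (A : Fin p → ℝ) (B : Fin q → ℝ) :
    foxChi m (n + k) (Fin.append A₀ A) B = foxChi m n A B + ∑ j, A₀ j := by
  -- The sums are obtained from the product lemmas in `Multiplicative ℝ`.
  have h1 := prod_filter_append_lt (n := n)
    (fun j => Multiplicative.ofAdd (Fin.append A₀ A j))
  have h2 := prod_filter_append_ge (n := n)
    (fun j => Multiplicative.ofAdd (Fin.append A₀ A j))
  simp only [← ofAdd_sum, ← ofAdd_add, EmbeddingLike.apply_eq_iff_eq, Fin.append_left,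
    Fin.append_right] at h1 h2
  rw [foxChi, foxChi, h1, h2]
  ring

theorem mem_realRightPoles_append {α₀ A₀ : Fin k → ℝ} {α A : Fin p → ℝ} {x : ℝ} :
    x ∈ realRightPoles (n + k) (Fin.append α₀ α) (Fin.append A₀ A) ↔
      (∃ j, ∃ l : ℕ, x = (1 - α₀ j + l) / A₀ j) ∨ x ∈ realRightPoles n α A := by
  constructor
  · rintro ⟨j, hj, l, rfl⟩
    revert hj
    refine Fin.addCases (fun i => ?_) (fun i => ?_) j
    · intro _
      exact Or.inl ⟨i, l, by simp⟩
    · intro hi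
      refine Or.inr ⟨i, ?_, l, by simp⟩
      simp only [Fin.val_natAdd] at hi
      omega
  · rintro (⟨j, l, rfl⟩ | ⟨j, hj, l, rfl⟩)
    · exact ⟨Fin.castAdd p j, by simp only [Fin.val_castAdd]; omega, l, by simp⟩
    · exact ⟨Fin.natAdd k j, by simp only [Fin.val_natAdd]; omega, l, by simp⟩

end Append

/-! ### The corollary. -/

theorem le_of_mem_realLeftPoles {m q : ℕ} {β B : Fin q → ℝ} (hB : ∀ j, 0 < B j) {x : ℝ}
    (hx : x ∈ realLeftPoles m β B) :
    x ≤ -⨅ l : {l : Fin q // (l : ℕ) < m}, β l.1 / B l.1 := by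
  obtain ⟨j, hj, l, rfl⟩ := hx
  have h1 := ciInf_le (f := fun l : {l : Fin q // (l : ℕ) < m} => β l.1 / B l.1)
    (finite_range _).bddBelow ⟨j, hj⟩
  have h2 : (0 : ℝ) ≤ l / B j := div_nonneg l.cast_nonneg (hB j).le
  rw [neg_div, add_div]
  simp only at h1
  linarith

theorem foxPolesDistinct_of_disjoint {m n p q : ℕ} {α A : Fin p → ℝ} {β B : Fin q → ℝ}
    (hA : ∀ j, 0 < A j) (hB : ∀ j, 0 < B j)
    (h : Disjoint (realLeftPoles m β B) (realRightPoles n α A)) :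
    FoxPolesDistinct m n (fun j => (α j : ℂ)) A (fun j => (β j : ℂ)) B := by
  intro j hj j' hj' l l' heq
  have heq' : A j * (l + β j') = B j' * (α j - l' - 1) := by
    beta_reduce at heq
    exact_mod_cast heq
  refine Set.disjoint_left.1 h ⟨j', hj', l, rfl⟩ ⟨j, hj, l', ?_⟩
  rw [div_eq_div_iff (hB j').ne' (hA j).ne']
  linarith

theorem corollary2
    (m n p q : ℕ) (hm : m ≤ q) (hn : n ≤ p)
    (α A : Fin p → ℝ) (β B : Fin q → ℝ)
    (hA : ∀ j, 0 < A j) (hB : ∀ j, 0 < B j)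
    (hpoles : FoxPolesDistinct m n (fun j => (α j : ℂ)) A (fun j => (β j : ℂ)) B)
    (hpos : ∀ t : ℝ, 0 < t →
      0 < foxH m n (fun j => (α j : ℂ)) A (fun j => (β j : ℂ)) B (t : ℂ))
    (hmn : 0 < m * n) (hχ : 0 < foxChi m n A B)
    (k : ℕ) (ω lam : Fin k → ℝ) (hlam : ∀ j, 0 < lam j)
    (hω : ∀ j, 0 < ω j + lam j * ⨅ l : {l : Fin q // (l : ℕ) < m}, β l.1 / B l.1) :
    FoxPolesDistinct m (n + k)
        (Fin.append (fun j : Fin k => ((1 - ω j.rev : ℝ) : ℂ)) (fun j => (α j : ℂ)))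
        (Fin.append (fun j : Fin k => lam j.rev) A) (fun j => (β j : ℂ)) B ∧
      ∀ t : ℝ, 0 < t →
        FoxHExists m (n + k)
          (Fin.append (fun j : Fin k => ((1 - ω j.rev : ℝ) : ℂ)) (fun j => (α j : ℂ)))
          (Fin.append (fun j : Fin k => lam j.rev) A) (fun j => (β j : ℂ)) B (t : ℂ) ∧
        0 < foxH m (n + k)
          (Fin.append (fun j : Fin k => ((1 - ω j.rev : ℝ) : ℂ)) (fun j => (α j : ℂ)))
          (Fin.append (fun j : Fin k => lam j.rev) A) (fun j => (β j : ℂ)) B (t : ℂ) := by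

  set β₀ := ⨅ l : {l : Fin q // (l : ℕ) < m}, β l.1 / B l.1 with hβ₀
  have hLle : ∀ x ∈ realLeftPoles m β B, x ≤ -β₀ := fun x hx => le_of_mem_realLeftPoles hB hx
  set α₁ : Fin k → ℝ := fun j => 1 - ω j.rev with hα₁
  set A₁ : Fin k → ℝ := fun j => lam j.rev with hA₁
  have hA' : ∀ j, 0 < Fin.append A₁ A j := fun j => by
    refine Fin.addCases (fun i => ?_) (fun i => ?_) j
    · simpa using hlam _
    · simpa using hA i
  have hω' : ∀ j, -β₀ < ω j / lam j := fun j => by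
    rw [lt_div_iff₀ (hlam j)]
    linarith [hω j]
  have happ : Fin.append (fun j : Fin k => ((1 - ω j.rev : ℝ) : ℂ)) (fun j => (α j : ℂ)) =
      fun j => ((Fin.append α₁ α j : ℝ) : ℂ) := append_ofReal α₁ α
  have hnew : ∀ x, (∃ j, ∃ l : ℕ, x = (1 - α₁ j + l) / A₁ j) → ∃ j, ω j / lam j ≤ x := by
    rintro _ ⟨j, l, rfl⟩
    refine ⟨j.rev, ?_⟩
    have h0 := hlam j.rev
    simp only [hα₁, hA₁, sub_sub_cancel]
    gcongr
    exact le_add_of_nonneg_right l.cast_nonneg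
  have hdisj : Disjoint (realLeftPoles m β B)
      (realRightPoles (n + k) (Fin.append α₁ α) (Fin.append A₁ A)) := by
    rw [Set.disjoint_left]
    intro x hx hx'
    rcases mem_realRightPoles_append.1 hx' with h | h
    · obtain ⟨j, hj⟩ := hnew x h
      linarith [hω' j, hLle x hx]
    · exact Set.disjoint_left.1 (disjoint_realPoles hA hB hpoles) hx h
  have hχ' : 0 < foxChi m (n + k) (Fin.append A₁ A) B := by
    rw [foxChi_append]
    exact add_pos_of_pos_of_nonneg hχ (Finset.sum_nonneg fun j _ => (hlam _).le)
  -- A filter argument instead of a minimum over `j`, so that `k = 0` needs no separate case.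
  obtain ⟨u, hu, hu'⟩ : ∃ u, -β₀ < u ∧ ∀ j, u < ω j / lam j := by
    have h : ∀ᶠ u in 𝓝[>] (-β₀), ∀ j, u < ω j / lam j := by
      rw [eventually_all]
      exact fun j => nhdsWithin_le_nhds (eventually_lt_nhds (hω' j))
    obtain ⟨u, h1, h2⟩ := (h.and self_mem_nhdsWithin).exists
    exact ⟨u, h2, h1⟩
  have hRfin := finite_realRightPoles_inter_Iic (n + k) (Fin.append α₁ α) hA'
  -- Only finitely many right poles lie in `(-β₀, u)`, so `c` can avoid them all.
  obtain ⟨c, ⟨hc1, hc2⟩, hc3⟩ := ((Ioo_infinite hu).sdiff (hRfin u)).nonempty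
  have hcP : c ∉ realRightPoles (n + k) (Fin.append α₁ α) (Fin.append A₁ A) := fun h =>
    hc3 ⟨h, hc2.le⟩
  obtain ⟨C, hCre, hC⟩ := exists_separating_contour
    (fun x hx => (hLle x hx).trans_lt hc1) hcP hdisj
    ((hRfin c).subset (inter_subset_inter_right _ Iio_subset_Iic_self))
    (finite_realLeftPoles_inter_Ici m β hB)
  have hCnew : IsFoxContour m (n + k) (fun j => ((Fin.append α₁ α j : ℝ) : ℂ))
      (Fin.append A₁ A) (fun j => (β j : ℂ)) B C := by
    rwa [IsFoxContour, foxLeftPoles_ofReal, foxRightPoles_ofReal]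
  -- The left poles are the same and the old right poles are among the new ones, so the same contour
  -- is admissible.
  have hCold : IsFoxContour m n (fun j => (α j : ℂ)) A (fun j => (β j : ℂ)) B C := by
    rw [IsFoxContour, foxLeftPoles_ofReal, foxRightPoles_ofReal]
    exact ⟨hC.1, fun a ha => hC.2 a (image_mono
      (fun x hx => mem_realRightPoles_append.2 (Or.inr hx)) ha)⟩
  rw [happ]
  refine ⟨foxPolesDistinct_of_disjoint hA' hB hdisj, fun t ht =>
    ⟨⟨⟨C, hCnew⟩, fun C' hC' => hC'.converges hA' hB hχ' ht⟩, ?_⟩⟩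
  rw [foxH_eq hCnew hA' hB hχ' ht]
  have hmain := integral_mul_prod_Gamma_pos (C := C) (c₂ := c) (Finset.univ : Finset (Fin k))
    (ω := fun j => ω j.rev) (lam := A₁) (verticalDecay_foxXi α β hA hB)
    (by positivity) (fun s hs => (hCold.differentiableAt hA hB hs).continuousAt.continuousWithinAt)
    hCre (fun j => hlam _)
    (fun j => by
      have := (lt_div_iff₀ (hlam j.rev)).1 (hc2.trans (hu' j.rev))
      rwa [mul_comm])
    (fun t ht => by
      rw [← foxH_eq hCold hA hB hχ ht]
      exact hpos t ht) t ht
  convert hmain using 6 with s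
  rw [← happ, foxXi_append]
  congr 1
  refine Finset.prod_congr rfl fun j _ => ?_
  push_cast
  rw [sub_sub_cancel]
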